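/- Let $\kappa,t_0\in\mathbb R$, $t_0<t_f\le\infty$, and let $a$ be a positive smooth function on $(t_0,t_f)$ with $a(t)\to 0$ as $t\downarrow t_0$. Let $M=(t_0,t_f)\times\Sigma_\kappa$ be the FLRW spacetime with metric $$-dt^2+a(t)^2 g_{\Sigma},\qquad g_\Sigma=\frac{dr^2}{1-\kappa r^2}+r^2(d\theta^2+\sin^2\theta\,d\varphi^2),$$ where $\Sigma_\kappa$ is the complete simply connected Riemannian three-manifold of constant curvature $\kappa$ (a sphere, $\mathbb R^3$ or hyperbolic space). Let $\gamma:I\to M$, $I$ an open interval, be a geodesic which runs into the singularity (the time coordinate $t(\gamma(\tau))$ takes values arbitrarily close to $t_0$), and which is either timelike with $g(\dot\gamma,\dot\gamma)=-1$ or null. Let $C=a^2\,g_{ij}\dot\gamma^i\dot\gamma^j$ (sum over the spatial indices), which is constant along $\gamma$, and suppose that $\gamma$ is not comoving: $C>0$. Put $$f=3\ddot a+\frac{2C}{a}\Big[\frac{\ddot a}{a}-\frac{\dot a^2}{a^2}-\frac{\kappa}{a^2}\Big],\qquad f_+=\max(f,0).$$ Suppose that for some $t_1\in(t_0,t_f)$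 $$\lim_{t\downarrow t_0}\int_t^{t_1}a(t')\int_{t'}^{t_1}\frac1a\Big[\frac{\ddot a}{a}-\frac{\dot a^2}{a^2}-\frac{\kappa}{a^2}\Big]dt''\,dt'=-\infty ,\qquad \lim_{t\downarrow t_0}\int_t^{t_1}f_+\,dt'=\alpha\in[0,\infty).$$ Then every point $\gamma(\tau_2)$, $\tau_2\in I$, with time coordinate $t_2=t(\gamma(\tau_2))$, is conjugate along $\gamma$ to a point of $\gamma$ at some time $t'$ with $t_0\le t'<t_2$. That is, at least one of the following holds. * (Case $t'>t_0$.) There are $\tau'\in I$ with $t(\gamma(\tau'))<t_2$ and a Jacobi field $J$ along $\gamma$ ($D_\tau^2J+R(J,\dot\gamma)\dot\gamma=0$), not identically zero, with $J(\tau_2)=0=J(\tau')$. * (Case $t'=t_0$, where the metric degenerates; generalized conjugacy.) There is a Jacobi field $J$ along $\gamma$, orthogonal to $\dot\gamma$ and not everywhere proportional to $\dot\gamma$, with $J(\tau_2)=0$ and $g(J,J)\to 0$ as $t\downarrow t_0$ along $\gamma$. -/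

import Mathlib

open Set Filter Topology

noncomputable section

/-! ## Semi-Riemannian geometry in a coordinate chart -/

/-- The partial derivative `∂ᵢ f` at `x`. -/
def partialD {n : ℕ} (i : Fin n) (f : (Fin n → ℝ) → ℝ) (x : Fin n → ℝ) : ℝ :=
  fderiv ℝ f x (Pi.single i 1)

/-- The Christoffel symbol `Γᵏᵢⱼ` of the metric with components `G x i j`. -/
def christoffel {n : ℕ} (G : (Fin n → ℝ) → Matrix (Fin n) (Fin n) ℝ) (k i j : Fin n)
    (x : Fin n → ℝ) : ℝ :=
  (1 / 2) * ∑ l, (G x)⁻¹ k l *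
    (partialD i (fun y => G y j l) x + partialD j (fun y => G y i l) x
      - partialD l (fun y => G y i j) x)

/-- The component `R^ρ_{σμν}` of the curvature tensor, `R(∂_μ, ∂_ν) ∂_σ = R^ρ_{σμν} ∂_ρ`, where
`R(X, Y) Z = ∇_X ∇_Y Z - ∇_Y ∇_X Z - ∇_{[X, Y]} Z`. -/
def riemannTensor {n : ℕ} (G : (Fin n → ℝ) → Matrix (Fin n) (Fin n) ℝ) (ρ σ μ ν : Fin n)
    (x : Fin n → ℝ) : ℝ :=
  partialD μ (christoffel G ρ ν σ) x - partialD ν (christoffel G ρ μ σ) x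
    + ∑ l, (christoffel G ρ μ l x * christoffel G l ν σ x
      - christoffel G ρ ν l x * christoffel G l μ σ x)

/-- The covariant derivative `D_τ V` of a vector field `V` along the curve `c`. -/
def covDeriv {n : ℕ} (G : (Fin n → ℝ) → Matrix (Fin n) (Fin n) ℝ) (c V : ℝ → Fin n → ℝ)
    (τ : ℝ) : Fin n → ℝ :=
  fun k => deriv V τ k + ∑ i, ∑ j, christoffel G k i j (c τ) * deriv c τ i * V τ j

/-- The vector `R(V, ċ) ċ` at parameter `τ`. -/
def curvatureAlong {n : ℕ} (G : (Fin n → ℝ) → Matrix (Fin n) (Fin n) ℝ) (c V : ℝ → Fin n → ℝ)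
    (τ : ℝ) : Fin n → ℝ :=
  fun ρ => ∑ σ, ∑ μ, ∑ ν,
    riemannTensor G ρ σ μ ν (c τ) * deriv c τ σ * V τ μ * deriv c τ ν

/-! ## FLRW spacetimes -/

/-- The interval `(t₀, tf)` of cosmic time; `tf = ⊤` is allowed. -/
def flrwTimes (t₀ : ℝ) (tf : EReal) : Set ℝ := {t | t₀ < t ∧ (t : EReal) < tf}

/-- The points `(t, x, w)` (`t = p 0`, `x = (p 1, p 2, p 3)`, `w = p 4`) of `(t₀, tf) × Σ_κ`, where
`Σ_κ = {(x, w) : w² + κ |x|² = 1}`, with `w > 0` if `κ ≤ 0`: a three-sphere for `κ > 0`,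
`ℝ³` (`w = 1`) for `κ = 0` and one sheet of a hyperboloid for `κ < 0`. -/
def flrwSpacetime (κ t₀ : ℝ) (tf : EReal) : Set (Fin 5 → ℝ) :=
  {p | p 0 ∈ flrwTimes t₀ tf ∧ p 4 ^ 2 + κ * (p 1 ^ 2 + p 2 ^ 2 + p 3 ^ 2) = 1 ∧
    (κ ≤ 0 → 0 < p 4)}

/-- `v` is tangent to `(t₀, tf) × Σ_κ` at `p` (for `κ = 0` this says `v 4 = 0`). -/
def flrwTangent (κ : ℝ) (p v : Fin 5 → ℝ) : Prop :=
  p 4 * v 4 + κ * (p 1 * v 1 + p 2 * v 2 + p 3 * v 3) = 0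

/-- The metric `|dx|² + dw² / κ` of `Σ_κ` on tangent vectors (for `κ = 0` the last term is absent,
as `dw = 0` on tangent vectors, in agreement with `κ⁻¹ = 0`). As `w² = 1 - κ r²` with `r = |x|`,
in spherical coordinates it is `dr² / (1 - κ r²) + r² (dθ² + sin² θ dφ²)`. -/
def spatialInner (κ : ℝ) (v w : Fin 5 → ℝ) : ℝ :=
  v 1 * w 1 + v 2 * w 2 + v 3 * w 3 + κ⁻¹ * (v 4 * w 4)

/-- The FLRW metric `-dt² + a(t)² g_Σ` at the point `p`, on tangent vectors. -/
def flrwInner (κ : ℝ) (a : ℝ → ℝ) (p v w : Fin 5 → ℝ) : ℝ :=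
  -(v 0 * w 0) + a (p 0) ^ 2 * spatialInner κ v w

/-- The components of the FLRW metric in isotropic coordinates `(t, y)`:
`-dt² + a(t)² |dy|² / (1 + κ |y|² / 4)²`. -/
def flrwMetric (κ : ℝ) (a : ℝ → ℝ) (q : Fin 4 → ℝ) : Matrix (Fin 4) (Fin 4) ℝ :=
  Matrix.diagonal fun i => if i = 0 then -1 else
    a (q 0) ^ 2 / (1 + κ * (q 1 ^ 2 + q 2 ^ 2 + q 3 ^ 2) / 4) ^ 2

/-- The stereographic charts `(t, x, w) ↦ (t, 2 x / (1 + s w))`, `s = 1` or `s = -1`, which are used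
where `1 + s w > 0`. For `κ ≤ 0` the first one covers everything (and the second one has empty
domain); for `κ > 0` the two together cover everything. -/
def flrwChart (s : ℝ) (p : Fin 5 → ℝ) : Fin 4 → ℝ :=
  ![p 0, 2 * p 1 / (1 + s * p 4), 2 * p 2 / (1 + s * p 4), 2 * p 3 / (1 + s * p 4)]

/-- The components in the chart `s` of the vector field `V` along `γ`. -/
def chartField (s : ℝ) (γ V : ℝ → Fin 5 → ℝ) (τ : ℝ) : Fin 4 → ℝ :=
  fderiv ℝ (flrwChart s) (γ τ) (V τ)

/-- The differential of a chart. -/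
theorem flrwChart_fderiv {s : ℝ} {p : Fin 5 → ℝ} (hs : 0 < 1 + s * p 4) (v : Fin 5 → ℝ) :
    fderiv ℝ (flrwChart s) p v =
      ![v 0, 2 * v 1 / (1 + s * p 4) - 2 * p 1 * (s * v 4) / (1 + s * p 4) ^ 2,
        2 * v 2 / (1 + s * p 4) - 2 * p 2 * (s * v 4) / (1 + s * p 4) ^ 2,
        2 * v 3 / (1 + s * p 4) - 2 * p 3 * (s * v 4) / (1 + s * p 4) ^ 2] := by
  have hp : ∀ i : Fin 5, HasFDerivAt (fun q : Fin 5 → ℝ => q i)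
      (ContinuousLinearMap.proj (R := ℝ) (φ := fun _ : Fin 5 => ℝ) i) p := fun i =>
    hasFDerivAt_apply i p
  have hd : HasFDerivAt (fun q : Fin 5 → ℝ => 1 + s * q 4) _ p :=
    ((hp 4).const_mul s).const_add 1
  have hq : ∀ i : Fin 5, HasFDerivAt (fun q : Fin 5 → ℝ => 2 * q i / (1 + s * q 4)) _ p :=
    fun i => ((hp i).const_mul 2).mul ((hasDerivAt_inv hs.ne').comp_hasFDerivAt p hd)
  have hF : HasFDerivAt (flrwChart s) (ContinuousLinearMap.pi fun k : Fin 4 =>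
      fderiv ℝ (fun q => flrwChart s q k) p) p := by
    rw [hasFDerivAt_pi]
    intro k
    fin_cases k
    · exact (hp 0).differentiableAt.hasFDerivAt
    · exact (hq 1).differentiableAt.hasFDerivAt
    · exact (hq 2).differentiableAt.hasFDerivAt
    · exact (hq 3).differentiableAt.hasFDerivAt
  rw [hF.fderiv]
  have hne := hs.ne'
  funext k
  fin_cases k
  · change fderiv ℝ (fun q : Fin 5 → ℝ => q 0) p v = _
    rw [(hp 0).fderiv]; rfl
  · change fderiv ℝ (fun q : Fin 5 → ℝ => 2 * q 1 / (1 + s * q 4)) p v = _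
    rw [(hq 1).fderiv]; simp; field_simp; ring
  · change fderiv ℝ (fun q : Fin 5 → ℝ => 2 * q 2 / (1 + s * q 4)) p v = _
    rw [(hq 2).fderiv]; simp; field_simp; ring
  · change fderiv ℝ (fun q : Fin 5 → ℝ => 2 * q 3 / (1 + s * q 4)) p v = _
    rw [(hq 3).fderiv]; simp; field_simp; ring

/-- The charts are isometries: `flrwMetric` gives the components of `flrwInner`. -/
theorem flrwMetric_chart {κ t₀ s : ℝ} {tf : EReal} (a : ℝ → ℝ) {p : Fin 5 → ℝ}
    (hp : p ∈ flrwSpacetime κ t₀ tf) (hs : s = 1 ∨ s = -1) (hd : 0 < 1 + s * p 4)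
    {v w : Fin 5 → ℝ} (hv : flrwTangent κ p v) (hw : flrwTangent κ p w) :
    ∑ i, ∑ j, flrwMetric κ a (flrwChart s p) i j * fderiv ℝ (flrwChart s) p v i *
      fderiv ℝ (flrwChart s) p w j = flrwInner κ a p v w := by
  obtain ⟨-, hq, hpos⟩ := hp
  have hs2 : s ^ 2 = 1 := by rcases hs with rfl | rfl <;> norm_num
  rw [flrwChart_fderiv hd, flrwChart_fderiv hd]
  unfold flrwTangent at hv hw
  have hne := hd.ne'
  have h2 : 1 + κ * ((2 * p 1 / (1 + s * p 4)) ^ 2 + (2 * p 2 / (1 + s * p 4)) ^ 2 +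
      (2 * p 3 / (1 + s * p 4)) ^ 2) / 4 = 2 / (1 + s * p 4) := by
    field_simp
    linear_combination 4 * hq + 4 * p 4 ^ 2 * hs2
  simp only [flrwMetric, flrwInner, spatialInner, flrwChart, Matrix.diagonal_apply, ite_mul,
    zero_mul, Finset.sum_ite_eq, Finset.mem_univ, if_true, Fin.sum_univ_four]
  simp only [Fin.isValue, Matrix.cons_val]
  simp only [h2, show (1 : Fin 4) ≠ 0 by decide, show (2 : Fin 4) ≠ 0 by decide,
    show (3 : Fin 4) ≠ 0 by decide, if_false]
  by_cases hκ : κ = 0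
  · subst hκ
    have h4 : p 4 = 1 := by nlinarith [hpos le_rfl]
    have hv4 : v 4 = 0 := by simpa [h4] using hv
    have hw4 : w 4 = 0 := by simpa [h4] using hw
    simp only [hv4, hw4, inv_zero]
    field_simp
    ring
  · have hx : p 1 * v 1 + p 2 * v 2 + p 3 * v 3 = -(p 4 * v 4) / κ := by
      field_simp; linarith
    have hy : p 1 * w 1 + p 2 * w 2 + p 3 * w 3 = -(p 4 * w 4) / κ := by
      field_simp; linarith
    have hr : p 1 ^ 2 + p 2 ^ 2 + p 3 ^ 2 = (1 - p 4 ^ 2) / κ := by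
      field_simp; linarith
    have key : ∀ x y z : ℝ, x ^ 2 / (2 / (1 + s * p 4)) ^ 2 * y * z =
        x ^ 2 * ((1 + s * p 4) ^ 2 / 4 * (y * z)) := by
      intro x y z; field_simp; ring
    rw [key, key, key, show -1 * v 0 * w 0 = -(v 0 * w 0) by ring]
    rw [add_assoc, add_assoc, ← mul_add, ← mul_add]
    congr 2
    trans v 1 * w 1 + v 2 * w 2 + v 3 * w 3
      - s * w 4 / (1 + s * p 4) * (p 1 * v 1 + p 2 * v 2 + p 3 * v 3)
      - s * v 4 / (1 + s * p 4) * (p 1 * w 1 + p 2 * w 2 + p 3 * w 3)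
      + s ^ 2 * v 4 * w 4 / (1 + s * p 4) ^ 2 * (p 1 ^ 2 + p 2 ^ 2 + p 3 ^ 2)
    · field_simp; ring
    · rw [hx, hy, hr]
      field_simp
      rcases hs with rfl | rfl <;> ring

/-- `γ : I → (t₀, tf) × Σ_κ` is a geodesic: `D_τ γ̇ = 0` in each chart. -/
structure IsFLRWGeodesic (κ : ℝ) (a : ℝ → ℝ) (t₀ : ℝ) (tf : EReal) (I : Set ℝ)
    (γ : ℝ → Fin 5 → ℝ) : Prop where
  smooth : ContDiffOn ℝ (⊤ : ℕ∞) γ I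
  mapsTo : MapsTo γ I (flrwSpacetime κ t₀ tf)
  geodesic_eq : ∀ s : ℝ, s = 1 ∨ s = -1 → ∀ τ ∈ I, 0 < 1 + s * γ τ 4 →
    covDeriv (flrwMetric κ a) (flrwChart s ∘ γ) (deriv (flrwChart s ∘ γ)) τ = 0

/-- `J` is a Jacobi field along `γ : I → (t₀, tf) × Σ_κ`: a smooth tangent vector field along `γ`
with `D_τ² J + R(J, γ̇) γ̇ = 0` in each chart. -/
structure IsJacobiField (κ : ℝ) (a : ℝ → ℝ) (I : Set ℝ) (γ J : ℝ → Fin 5 → ℝ) : Prop where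
  smooth : ContDiffOn ℝ (⊤ : ℕ∞) J I
  tangent : ∀ τ ∈ I, flrwTangent κ (γ τ) (J τ)
  jacobi_eq : ∀ s : ℝ, s = 1 ∨ s = -1 → ∀ τ ∈ I, 0 < 1 + s * γ τ 4 →
    covDeriv (flrwMetric κ a) (flrwChart s ∘ γ)
        (covDeriv (flrwMetric κ a) (flrwChart s ∘ γ) (chartField s γ J)) τ
      + curvatureAlong (flrwMetric κ a) (flrwChart s ∘ γ) (chartField s γ J) τ = 0

/-- `γ(τ₁)` and `γ(τ₂)` are conjugate along `γ`: a nontrivial Jacobi field vanishes at both. -/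
def ConjugateAlong (κ : ℝ) (a : ℝ → ℝ) (I : Set ℝ) (γ : ℝ → Fin 5 → ℝ) (τ₁ τ₂ : ℝ) : Prop :=
  ∃ J : ℝ → Fin 5 → ℝ, IsJacobiField κ a I γ J ∧ (∃ τ ∈ I, J τ ≠ 0) ∧ J τ₁ = 0 ∧ J τ₂ = 0

/-- The filter of parameters `τ ∈ I` with `t(γ(τ)) → t₀`. -/
def towardsSingularity (t₀ : ℝ) (I : Set ℝ) (γ : ℝ → Fin 5 → ℝ) : Filter ℝ :=
  comap (fun τ => γ τ 0) (𝓝[>] t₀) ⊓ 𝓟 I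

/-- `γ(τ₂)` is conjugate, in the generalized sense, to the endpoint of `γ` at the singularity
`t = t₀`: there is a Jacobi field `J` orthogonal to `γ̇`, vanishing at `τ₂`, which is nontrivial
modulo `γ̇` (for a timelike geodesic this only says `J ≠ 0`; for a null geodesic, where `γ̇` is
orthogonal to itself, it says that the class of `J` in the quotient by `γ̇` is nontrivial), and
whose norm tends to zero at the singularity. -/
def ConjugateToSingularity (κ : ℝ) (a : ℝ → ℝ) (t₀ : ℝ) (I : Set ℝ) (γ : ℝ → Fin 5 → ℝ)
    (τ₂ : ℝ) : Prop :=
  ∃ J : ℝ → Fin 5 → ℝ, IsJacobiField κ a I γ J ∧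
    (∀ τ ∈ I, flrwInner κ a (γ τ) (J τ) (deriv γ τ) = 0) ∧
    (¬ ∀ τ ∈ I, ∃ c : ℝ, J τ = c • deriv γ τ) ∧
    J τ₂ = 0 ∧
    Tendsto (fun τ => flrwInner κ a (γ τ) (J τ) (J τ)) (towardsSingularity t₀ I γ) (𝓝 0)

/-- `(1 / a) (ä / a - ȧ² / a² - κ / a²)`. -/
def curvatureTerm (κ : ℝ) (a : ℝ → ℝ) (t : ℝ) : ℝ :=
  1 / a t * (deriv (deriv a) t / a t - deriv a t ^ 2 / a t ^ 2 - κ / a t ^ 2)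

/-- `f = 3 ä + (2 C / a) (ä / a - ȧ² / a² - κ / a²)`. -/
def focusingFun (κ C : ℝ) (a : ℝ → ℝ) (t : ℝ) : ℝ :=
  3 * deriv (deriv a) t +
    2 * (C / a t) * (deriv (deriv a) t / a t - deriv a t ^ 2 / a t ^ 2 - κ / a t ^ 2)

end

/-! The second alternative always holds, with an explicit field. Along `γ` each of the three
coordinates `x` of the ambient space of `Σ_κ` solves the linear equation `z'' + 2 (a'/a) t' z' + κ
r² z = 0`, where `r = √C / a²` is the speed of the projection to `Σ_κ` (`IsFLRWGeodesic.space_eq`).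
Choose `e ≠ 0` in `ℝ³` orthogonal to `x` and `x'` at `τ₂`. By uniqueness (`eq_zero_of_spatial_ode`)
`e · x` vanishes identically, so `γ` stays in a totally geodesic hypersurface whose normal has the
constant direction `e`. Then `ψ e` is a Jacobi field as soon as `ψ` solves the same equation
(`IsFLRWGeodesic.isJacobiField_ambientField`). Take `ψ = sn_κ(θ)`, with `θ` the arc length in `Σ_κ`
measured from `τ₂`: the field vanishes at `τ₂`, is orthogonal to `γ̇`, and is not a multiple of `γ̇`
because `t' ≠ 0`.

Its squared norm is `(a ψ)² |e|²`, so it remains to show `a ψ → 0`. For `κ > 0` this holds because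
`sn_κ` is bounded and `a → 0`. For `κ ≤ 0` causality gives `a r ≤ |t'|`, hence `|θ| ≤ η` with `η`
the conformal time, which reduces the claim to `a sn_κ(η) → 0` (`tendsto_scale_mul_curvSin`). There
a Riccati equation for the logarithmic derivative of `a (cn_κ + sn_κ)(η)` bounds its logarithm above
by the double integral of the curvature term, up to a constant.

The Jacobi equation is verified without computing the curvature tensor: its operator is the
linearisation of the geodesic operator (`covDeriv_covDeriv_add_curvatureAlong`), and
`isotropic_operator_mul` translates between the charts and the ambient space. -/

/-! ### The Jacobi operator in coordinates. -/

theorem fderiv_apply_eq_sum_partialD {n : ℕ} (f : (Fin n → ℝ) → ℝ) (x v : Fin n → ℝ) :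
    fderiv ℝ f x v = ∑ l, partialD l f x * v l := by
  have h := LinearMap.pi_apply_eq_sum_univ (fderiv ℝ f x).toLinearMap v
  simp only [ContinuousLinearMap.coe_coe, smul_eq_mul] at h
  rw [h]
  refine Finset.sum_congr rfl fun l _ => ?_
  rw [mul_comm, partialD]
  congr 2
  funext j
  simp [Pi.single_apply, eq_comm]

theorem sum_comm_pairs {n : ℕ} (F : Fin n → Fin n → Fin n → Fin n → ℝ) :
    ∑ i, ∑ j, ∑ p, ∑ q, F i j p q = ∑ p, ∑ q, ∑ i, ∑ j, F i j p q := by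
  rw [Finset.sum_congr rfl fun i _ => Finset.sum_comm, Finset.sum_comm]
  refine Finset.sum_congr rfl fun p _ => ?_
  rw [Finset.sum_congr rfl fun i _ => Finset.sum_comm, Finset.sum_comm]

/-- The derivative of a covariant derivative. -/
theorem deriv_covDeriv_apply {n : ℕ} {G : (Fin n → ℝ) → Matrix (Fin n) (Fin n) ℝ}
    {c V : ℝ → Fin n → ℝ} {τ : ℝ}
    (hΓ : ∀ k i j, DifferentiableAt ℝ (christoffel G k i j) (c τ))
    (hc : ContDiffAt ℝ 2 c τ) (hV : ContDiffAt ℝ 2 V τ) (k : Fin n) :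
    deriv (covDeriv G c V) τ k = deriv (deriv V) τ k + ∑ i, ∑ j,
      ((fderiv ℝ (christoffel G k i j) (c τ) (deriv c τ) * deriv c τ i
        + christoffel G k i j (c τ) * deriv (deriv c) τ i) * V τ j
        + christoffel G k i j (c τ) * deriv c τ i * deriv V τ j) := by
  have h1 : ∀ {f : ℝ → Fin n → ℝ}, ContDiffAt ℝ 2 f τ → HasDerivAt f (deriv f τ) τ :=
    fun hf => (hf.differentiableAt (by norm_num)).hasDerivAt
  have h2 : ∀ {f : ℝ → Fin n → ℝ}, ContDiffAt ℝ 2 f τ →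
      HasDerivAt (deriv f) (deriv (deriv f) τ) τ := fun {f} hf => by
    have : ContDiffAt ℝ 1 (deriv f) τ := by
      exact hf.derivWithin (by norm_num)
    exact (this.differentiableAt (by norm_num)).hasDerivAt
  have key : HasDerivAt (covDeriv G c V) (fun k => deriv (deriv V) τ k + ∑ i, ∑ j,
      ((fderiv ℝ (christoffel G k i j) (c τ) (deriv c τ) * deriv c τ i
        + christoffel G k i j (c τ) * deriv (deriv c) τ i) * V τ j
        + christoffel G k i j (c τ) * deriv c τ i * deriv V τ j)) τ := by
    rw [hasDerivAt_pi]
    intro k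
    refine ((hasDerivAt_pi.1 (h2 hV)) k).add ?_
    refine HasDerivAt.fun_sum fun i _ => HasDerivAt.fun_sum fun j _ => ?_
    exact ((((hΓ k i j).hasFDerivAt.comp_hasDerivAt τ (h1 hc)).mul
      ((hasDerivAt_pi.1 (h2 hc)) i)).mul ((hasDerivAt_pi.1 (h1 hV)) j))
  rw [key.deriv]

/-- The Jacobi operator is the linearisation of the geodesic operator. -/
theorem covDeriv_covDeriv_add_curvatureAlong {n : ℕ}
    {G : (Fin n → ℝ) → Matrix (Fin n) (Fin n) ℝ} {c V : ℝ → Fin n → ℝ} {τ : ℝ}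
    (hsymm : ∀ k i j, christoffel G k i j = christoffel G k j i)
    (hΓ : ∀ k i j, DifferentiableAt ℝ (christoffel G k i j) (c τ))
    (hc : ContDiffAt ℝ 2 c τ) (hV : ContDiffAt ℝ 2 V τ) (k : Fin n) :
    (covDeriv G c (covDeriv G c V) τ + curvatureAlong G c V τ) k =
      deriv (deriv V) τ k
      + 2 * ∑ i, ∑ j, christoffel G k i j (c τ) * deriv c τ i * deriv V τ j
      + ∑ i, ∑ j, fderiv ℝ (christoffel G k i j) (c τ) (V τ) * deriv c τ i * deriv c τ j
      + ∑ i, ∑ j, christoffel G k i j (c τ) * covDeriv G c (deriv c) τ i * V τ j := by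
  rw [Pi.add_apply, covDeriv, deriv_covDeriv_apply hΓ hc hV]
  simp only [fderiv_apply_eq_sum_partialD, covDeriv, curvatureAlong, riemannTensor]
  set u := deriv c τ
  set u' := deriv (deriv c) τ
  set v := V τ
  set v' := deriv V τ
  -- The four kinds of terms: `e1` and `e3` cancel against the negative halves of the curvature,
  -- `e2` rewrites the derivative of `Γ` along `V` as a positive curvature term, and `e4` is the
  -- part of `Γ (D_τ ċ) V` supplied by the other one.
  have e1 : ∑ i, ∑ j, (∑ l, partialD l (christoffel G k i j) (c τ) * u l) * u i * v j
      = ∑ σ, ∑ μ, ∑ ν, partialD ν (christoffel G k μ σ) (c τ) * u σ * v μ * u ν := by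
    refine Finset.sum_congr rfl fun i _ => Finset.sum_congr rfl fun j _ => ?_
    rw [Finset.sum_mul, Finset.sum_mul, hsymm k i j]
    exact Finset.sum_congr rfl fun l _ => by ring
  have e2 : ∑ i, ∑ j, (∑ l, partialD l (christoffel G k i j) (c τ) * v l) * u i * u j
      = ∑ σ, ∑ μ, ∑ ν, partialD μ (christoffel G k ν σ) (c τ) * u σ * v μ * u ν := by
    simp only [Finset.sum_mul]
    rw [Finset.sum_comm]
    refine Finset.sum_congr rfl fun j _ => ?_
    rw [Finset.sum_comm]
    exact Finset.sum_congr rfl fun l _ => Finset.sum_congr rfl fun i _ => by ring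
  have e3 : ∑ i, ∑ j, christoffel G k i j (c τ) * u i *
        (∑ p, ∑ q, christoffel G j p q (c τ) * u p * v q)
      = ∑ σ, ∑ μ, ∑ ν, (∑ l, christoffel G k ν l (c τ) * christoffel G l μ σ (c τ))
          * u σ * v μ * u ν := by
    simp only [Finset.mul_sum, Finset.sum_mul]
    rw [sum_comm_pairs]
    refine Finset.sum_congr rfl fun p _ => Finset.sum_congr rfl fun q _ =>
      Finset.sum_congr rfl fun i _ => Finset.sum_congr rfl fun j _ => ?_
    rw [hsymm j q p]
    ring
  have e4 : ∑ i, ∑ j, christoffel G k i j (c τ) *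
        (∑ p, ∑ q, christoffel G i p q (c τ) * u p * u q) * v j
      = ∑ σ, ∑ μ, ∑ ν, (∑ l, christoffel G k μ l (c τ) * christoffel G l ν σ (c τ))
          * u σ * v μ * u ν := by
    simp only [Finset.mul_sum, Finset.sum_mul]
    rw [sum_comm_pairs]
    refine Finset.sum_congr rfl fun p _ => ?_
    rw [Finset.sum_congr rfl fun q _ => Finset.sum_comm, Finset.sum_comm]
    refine Finset.sum_congr rfl fun j _ => Finset.sum_congr rfl fun q _ =>
      Finset.sum_congr rfl fun i _ => ?_
    rw [hsymm i q p, hsymm k i j]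
    ring
  simp only [add_mul, sub_mul, mul_add, Finset.sum_add_distrib, Finset.sum_sub_distrib]
  rw [e1, e2, e3, e4]
  ring

/-! ### Christoffel symbols of the FLRW metric in isotropic coordinates. -/

/-- The conformal denominator `1 + κ |y|² / 4` of the spatial metric in isotropic coordinates. -/
noncomputable def isotropicDenom (κ : ℝ) (q : Fin 4 → ℝ) : ℝ :=
  1 + κ * (q 1 ^ 2 + q 2 ^ 2 + q 3 ^ 2) / 4

/-- Half the logarithmic derivatives of the spatial conformal factor. -/
noncomputable def flrwLogDeriv (κ : ℝ) (a : ℝ → ℝ) (i : Fin 4) (q : Fin 4 → ℝ) : ℝ :=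
  if i = 0 then deriv a (q 0) / a (q 0) else -(κ * q i) / (2 * isotropicDenom κ q)

/-- The Christoffel symbols of the FLRW metric in closed form. -/
noncomputable def flrwGamma (κ : ℝ) (a : ℝ → ℝ) (k i j : Fin 4) (q : Fin 4 → ℝ) : ℝ :=
  if k = 0 then
    if i = j ∧ i ≠ 0 then a (q 0) * deriv a (q 0) / isotropicDenom κ q ^ 2 else 0
  else (if j = k then flrwLogDeriv κ a i q else 0) + (if i = k then flrwLogDeriv κ a j q else 0)
    - (if i = j ∧ i ≠ 0 then flrwLogDeriv κ a k q else 0)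

theorem hasFDerivAt_coord {n : ℕ} (i : Fin n) (q : Fin n → ℝ) :
    HasFDerivAt (fun p : Fin n → ℝ => p i)
      (ContinuousLinearMap.proj (R := ℝ) (φ := fun _ : Fin n => ℝ) i) q :=
  hasFDerivAt_apply i q

theorem partialD_flrwMetric_spatial {κ : ℝ} {a : ℝ → ℝ} {q : Fin 4 → ℝ}
    (ha : DifferentiableAt ℝ a (q 0)) (hq : isotropicDenom κ q ≠ 0) (ha0 : a (q 0) ≠ 0)
    (i : Fin 4) :
    partialD i (fun p => a (p 0) ^ 2 / (1 + κ * (p 1 ^ 2 + p 2 ^ 2 + p 3 ^ 2) / 4) ^ 2) q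
      = 2 * (a (q 0) ^ 2 / isotropicDenom κ q ^ 2) * flrwLogDeriv κ a i q := by
  have hsq : ∀ i : Fin 4, HasFDerivAt (fun p : Fin 4 → ℝ => p i ^ 2) _ q := fun i =>
    (hasFDerivAt_coord i q).pow 2
  have h1 : HasFDerivAt (fun p : Fin 4 → ℝ => a (p 0) ^ 2) _ q :=
    (ha.hasDerivAt.comp_hasFDerivAt q (hasFDerivAt_coord 0 q)).pow 2
  have h2 : HasFDerivAt (fun p : Fin 4 → ℝ =>
      (1 + κ * (p 1 ^ 2 + p 2 ^ 2 + p 3 ^ 2) / 4) ^ 2) _ q :=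
    ((((((hsq 1).add (hsq 2)).add (hsq 3)).const_mul κ).mul_const (1 / 4 : ℝ)).const_add 1).pow 2
      |>.congr_of_eventuallyEq (by
        refine Eventually.of_forall fun p => ?_
        simp only [Pi.add_apply]; ring)
  have hq' : (1 + κ * (q 1 ^ 2 + q 2 ^ 2 + q 3 ^ 2) / 4) ^ 2 ≠ 0 := pow_ne_zero 2 hq
  have h3 : HasFDerivAt (fun p : Fin 4 → ℝ =>
      a (p 0) ^ 2 / (1 + κ * (p 1 ^ 2 + p 2 ^ 2 + p 3 ^ 2) / 4) ^ 2) _ q :=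
    h1.mul ((hasDerivAt_inv hq').comp_hasFDerivAt q h2)
  rw [partialD, h3.fderiv]
  unfold isotropicDenom at *
  fin_cases i <;> simp [flrwLogDeriv, isotropicDenom] <;> field_simp <;> ring

theorem partialD_flrwMetric {κ : ℝ} {a : ℝ → ℝ} {q : Fin 4 → ℝ}
    (ha : DifferentiableAt ℝ a (q 0)) (hq : isotropicDenom κ q ≠ 0) (ha0 : a (q 0) ≠ 0)
    (l i j : Fin 4) :
    partialD l (fun p => flrwMetric κ a p i j) q = if i = j ∧ i ≠ 0 then
      2 * (a (q 0) ^ 2 / isotropicDenom κ q ^ 2) * flrwLogDeriv κ a l q else 0 := by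
  split_ifs with h
  · obtain ⟨rfl, h0⟩ := h
    rw [← partialD_flrwMetric_spatial ha hq ha0]
    simp [flrwMetric, h0]
  · have : (fun p => flrwMetric κ a p i j) = fun _ => if i = j then -1 else 0 := by
      funext p
      by_cases hij : i = j
      · subst hij
        have : i = 0 := by simpa using h
        simp [flrwMetric, this]
      · simp [flrwMetric, hij]
    rw [this, partialD]
    simp

theorem flrwMetric_inv {κ : ℝ} {a : ℝ → ℝ} {q : Fin 4 → ℝ}
    (hq : isotropicDenom κ q ≠ 0) (ha0 : a (q 0) ≠ 0) :
    (flrwMetric κ a q)⁻¹ = Matrix.diagonal fun i => if i = 0 then -1 else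
      isotropicDenom κ q ^ 2 / a (q 0) ^ 2 := by
  apply Matrix.inv_eq_right_inv
  rw [flrwMetric, Matrix.diagonal_mul_diagonal, ← Matrix.diagonal_one]
  congr 1
  funext i
  change isotropicDenom κ q ≠ 0 at hq
  by_cases hi : i = 0
  · simp [hi]
  · simp only [hi, if_false]
    change a (q 0) ^ 2 / isotropicDenom κ q ^ 2 * _ = _
    field_simp

/-- The metric is diagonal, so only `l = k` survives in the sum. The derivative of a spatial entry
is twice the entry times a logarithmic derivative; for spatial `k` the entry cancels against the
inverse metric. -/
theorem christoffel_flrwMetric {κ : ℝ} {a : ℝ → ℝ} {q : Fin 4 → ℝ}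
    (ha : DifferentiableAt ℝ a (q 0)) (hq : isotropicDenom κ q ≠ 0) (ha0 : a (q 0) ≠ 0)
    (k i j : Fin 4) :
    christoffel (flrwMetric κ a) k i j q = flrwGamma κ a k i j q := by
  simp only [christoffel, partialD_flrwMetric ha hq ha0, flrwMetric_inv hq ha0,
    Matrix.diagonal_apply, ite_mul, zero_mul, Finset.sum_ite_eq, Finset.mem_univ, if_true,
    flrwGamma]
  by_cases hk : k = 0
  · subst hk
    have h1 : ∀ i : Fin 4, ¬ (i = 0 ∧ i ≠ 0) := fun i h => h.2 h.1
    simp only [h1, if_false, if_true]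
    split_ifs <;> simp [flrwLogDeriv] <;> field_simp
  · have h1 : ∀ i : Fin 4, (i = k ∧ i ≠ 0) ↔ i = k :=
      fun i => ⟨fun h => h.1, fun h => ⟨h, h ▸ hk⟩⟩
    simp only [h1, hk, if_false]
    set B := isotropicDenom κ q
    split_ifs <;> field_simp <;> ring

theorem christoffel_flrwMetric_symm (κ : ℝ) (a : ℝ → ℝ) (k i j : Fin 4) :
    christoffel (flrwMetric κ a) k i j = christoffel (flrwMetric κ a) k j i := by
  have h : ∀ x : Fin 4 → ℝ, ∀ i j, flrwMetric κ a x i j = flrwMetric κ a x j i := fun x i j => by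
    simp only [flrwMetric, Matrix.diagonal_apply]
    by_cases hij : i = j
    · rw [hij]
    · rw [if_neg hij, if_neg (Ne.symm hij)]
  funext x
  simp only [christoffel, h _ i j]
  congr 1
  exact Finset.sum_congr rfl fun l _ => by ring

theorem sum_flrwGamma_zero (κ : ℝ) (a : ℝ → ℝ) (q u v : Fin 4 → ℝ) :
    ∑ i, ∑ j, flrwGamma κ a 0 i j q * u i * v j =
      a (q 0) * deriv a (q 0) / isotropicDenom κ q ^ 2 * (u 1 * v 1 + u 2 * v 2 + u 3 * v 3) := by
  simp [flrwGamma, Fin.sum_univ_four]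
  ring

theorem sum_flrwGamma_spatial (κ : ℝ) (a : ℝ → ℝ) (q u v : Fin 4 → ℝ) {k : Fin 4} (hk : k ≠ 0) :
    ∑ i, ∑ j, flrwGamma κ a k i j q * u i * v j =
      deriv a (q 0) / a (q 0) * (u 0 * v k + v 0 * u k)
      - κ / (2 * isotropicDenom κ q) * ((q 1 * u 1 + q 2 * u 2 + q 3 * u 3) * v k
        + (q 1 * v 1 + q 2 * v 2 + q 3 * v 3) * u k
        - (u 1 * v 1 + u 2 * v 2 + u 3 * v 3) * q k) := by
  fin_cases k
  · exact absurd rfl hk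
  all_goals
    simp [flrwGamma, flrwLogDeriv, Fin.sum_univ_four]
    ring

theorem differentiable_isotropicDenom (κ : ℝ) : Differentiable ℝ (isotropicDenom κ) := by
  unfold isotropicDenom
  fun_prop

theorem differentiableAt_flrwLogDeriv {κ : ℝ} {a : ℝ → ℝ} {q : Fin 4 → ℝ}
    (ha : ContDiffAt ℝ 2 a (q 0)) (hq : isotropicDenom κ q ≠ 0) (ha0 : a (q 0) ≠ 0)
    (i : Fin 4) : DifferentiableAt ℝ (flrwLogDeriv κ a i) q := by
  have h0 : DifferentiableAt ℝ (fun p : Fin 4 → ℝ => p 0) q := by fun_prop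
  have h1 : DifferentiableAt ℝ (fun p : Fin 4 → ℝ => a (p 0)) q :=
    (ha.differentiableAt (by norm_num)).comp q h0
  have h2 : DifferentiableAt ℝ (fun p : Fin 4 → ℝ => deriv a (p 0)) q :=
    DifferentiableAt.comp (g := deriv a) q
      ((ha.derivWithin (m := 1) (by norm_num)).differentiableAt (by norm_num)) h0
  have h3 := differentiable_isotropicDenom κ q
  unfold flrwLogDeriv
  by_cases hi : i = 0
  · simp only [hi, if_true, div_eq_mul_inv]
    exact h2.fun_mul (h1.inv ha0)
  · simp only [hi, if_false]
    have h5 : 2 * isotropicDenom κ q ≠ 0 := mul_ne_zero two_ne_zero hq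
    fun_prop (disch := assumption)

theorem differentiableAt_flrwGamma {κ : ℝ} {a : ℝ → ℝ} {q : Fin 4 → ℝ}
    (ha : ContDiffAt ℝ 2 a (q 0)) (hq : isotropicDenom κ q ≠ 0) (ha0 : a (q 0) ≠ 0)
    (k i j : Fin 4) : DifferentiableAt ℝ (flrwGamma κ a k i j) q := by
  have h0 : DifferentiableAt ℝ (fun p : Fin 4 → ℝ => p 0) q := by fun_prop
  have h1 : DifferentiableAt ℝ (fun p : Fin 4 → ℝ => a (p 0)) q :=
    (ha.differentiableAt (by norm_num)).comp q h0
  have h2 : DifferentiableAt ℝ (fun p : Fin 4 → ℝ => deriv a (p 0)) q :=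
    DifferentiableAt.comp (g := deriv a) q
      ((ha.derivWithin (m := 1) (by norm_num)).differentiableAt (by norm_num)) h0
  have h3 := differentiable_isotropicDenom κ q
  have h4 := differentiableAt_flrwLogDeriv ha hq ha0
  unfold flrwGamma
  by_cases hk : k = 0
  · simp only [hk, if_true, div_eq_mul_inv]
    split_ifs
    · exact (h1.fun_mul h2).fun_mul ((h3.fun_pow 2).inv (pow_ne_zero 2 hq))
    · exact differentiableAt_const 0
  · simp only [hk, if_false]
    refine (DifferentiableAt.fun_add ?_ ?_).fun_sub ?_ <;> split_ifs <;>
      first | exact h4 _ | exact differentiableAt_const 0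

/-- Equality on a neighbourhood, not just at `q`, is what allows the closed form to be
differentiated. -/
theorem christoffel_eventuallyEq {κ : ℝ} {a : ℝ → ℝ} {q : Fin 4 → ℝ}
    (ha : ContDiffAt ℝ 2 a (q 0)) (hq : isotropicDenom κ q ≠ 0) (ha0 : a (q 0) ≠ 0)
    (k i j : Fin 4) :
    christoffel (flrwMetric κ a) k i j =ᶠ[𝓝 q] flrwGamma κ a k i j := by
  have hc : Tendsto (fun p : Fin 4 → ℝ => p 0) (𝓝 q) (𝓝 (q 0)) := (continuous_apply 0).tendsto q
  have h1 : ∀ᶠ t in 𝓝 (q 0), DifferentiableAt ℝ a t := by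
    filter_upwards [ha.eventually (by simp)] with t ht using ht.differentiableAt (by norm_num)
  have h2 : ∀ᶠ t in 𝓝 (q 0), a t ≠ 0 := ha.continuousAt.eventually_ne ha0
  have h3 : ∀ᶠ p in 𝓝 q, isotropicDenom κ p ≠ 0 :=
    (differentiable_isotropicDenom κ).continuous.continuousAt.eventually_ne hq
  filter_upwards [hc.eventually h1, hc.eventually h2, h3] with p hp1 hp2 hp3
  exact christoffel_flrwMetric hp1 hp3 hp2 k i j

theorem differentiableAt_christoffel_flrwMetric {κ : ℝ} {a : ℝ → ℝ} {q : Fin 4 → ℝ}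
    (ha : ContDiffAt ℝ 2 a (q 0)) (hq : isotropicDenom κ q ≠ 0) (ha0 : a (q 0) ≠ 0)
    (k i j : Fin 4) : DifferentiableAt ℝ (christoffel (flrwMetric κ a) k i j) q :=
  (differentiableAt_flrwGamma ha hq ha0 k i j).congr_of_eventuallyEq
    (christoffel_eventuallyEq ha hq ha0 k i j)

theorem fderiv_isotropicDenom (κ : ℝ) (q v : Fin 4 → ℝ) :
    fderiv ℝ (isotropicDenom κ) q v = κ * (q 1 * v 1 + q 2 * v 2 + q 3 * v 3) / 2 := by
  have hsq : ∀ i : Fin 4, HasFDerivAt (fun p : Fin 4 → ℝ => p i ^ 2) _ q := fun i =>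
    (hasFDerivAt_coord i q).pow 2
  have h2 : HasFDerivAt (isotropicDenom κ) _ q :=
    ((((((hsq 1).add (hsq 2)).add (hsq 3)).const_mul κ).mul_const (1 / 4 : ℝ)).const_add 1)
      |>.congr_of_eventuallyEq (by
        refine Eventually.of_forall fun p => ?_
        simp only [Pi.add_apply, isotropicDenom]; ring)
  rw [h2.fderiv]
  simp
  ring

/-- In a direction in which time and the conformal denominator are stationary, only the linear
numerators of the Christoffel symbols vary. -/
theorem sum_fderiv_christoffel_flrwMetric {κ : ℝ} {a : ℝ → ℝ} {q u v : Fin 4 → ℝ}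
    (ha : ContDiffAt ℝ 2 a (q 0)) (hq : isotropicDenom κ q ≠ 0) (ha0 : a (q 0) ≠ 0)
    (hv0 : v 0 = 0) (hqv : q 1 * v 1 + q 2 * v 2 + q 3 * v 3 = 0)
    (huv : u 1 * v 1 + u 2 * v 2 + u 3 * v 3 = 0) (k : Fin 4) :
    ∑ i, ∑ j, fderiv ℝ (christoffel (flrwMetric κ a) k i j) q v * u i * u j =
      κ / (2 * isotropicDenom κ q) * (u 1 ^ 2 + u 2 ^ 2 + u 3 ^ 2) * v k := by
  -- The derivative in the direction `v` is taken along this line, on which time is constant and the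
  -- conformal denominator is stationary to first order.
  set line : ℝ → Fin 4 → ℝ := fun h => q + h • v with hline
  have hl0 : line 0 = q := by simp [hline]
  have hl : HasDerivAt line v 0 := by
    rw [hasDerivAt_pi]
    intro i
    simpa [hline] using ((hasDerivAt_id (0 : ℝ)).mul_const (v i)).const_add (q i)
  have hΦ : HasDerivAt (fun h => isotropicDenom κ (line h)) 0 0 := by
    have := (differentiable_isotropicDenom κ (line 0)).hasFDerivAt.comp_hasDerivAt (0 : ℝ) hl
    rwa [hl0, fderiv_isotropicDenom, hqv, mul_zero, zero_div] at this
  have ht : ∀ h, line h 0 = q 0 := fun h => by simp [hline, hv0]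
  have hβ : ∀ i, HasDerivAt (fun h => flrwLogDeriv κ a i (line h))
      (-(κ * v i) / (2 * isotropicDenom κ q)) 0 := by
    intro i
    unfold flrwLogDeriv
    by_cases hi : i = 0
    · simp only [hi, if_true, ht, hv0, mul_zero, neg_zero, zero_div]
      exact hasDerivAt_const _ _
    · simp only [hi, if_false]
      have := (((hasDerivAt_pi.1 hl i).const_mul κ).fun_neg).fun_div (hΦ.const_mul 2)
        (by simpa [hl0] using hq)
      convert! this using 1
      rw [hl0]
      field_simp
      ring
  have hΓ : ∀ i j, fderiv ℝ (christoffel (flrwMetric κ a) k i j) q v =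
      if k = 0 then 0 else
      (if j = k then -(κ * v i) / (2 * isotropicDenom κ q) else 0)
        + (if i = k then -(κ * v j) / (2 * isotropicDenom κ q) else 0)
        - (if i = j ∧ i ≠ 0 then -(κ * v k) / (2 * isotropicDenom κ q) else 0) := by
    intro i j
    rw [(christoffel_eventuallyEq ha hq ha0 k i j).fderiv_eq]
    have h1 := ((differentiableAt_flrwGamma (κ := κ) (q := line 0) (by rwa [hl0]) (by rwa [hl0])
      (by rwa [hl0]) k i j).hasFDerivAt.comp_hasDerivAt (0 : ℝ) hl)
    rw [hl0] at h1
    refine h1.unique ?_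
    change HasDerivAt (fun h => flrwGamma κ a k i j (line h)) _ 0
    unfold flrwGamma
    by_cases hk : k = 0
    · simp only [hk, if_true, ht]
      split_ifs
      · have := (hasDerivAt_const (0 : ℝ) (a (q 0) * deriv a (q 0))).fun_div (hΦ.fun_pow 2)
          (by simpa [hl0] using hq)
        simpa using this
      · exact hasDerivAt_const _ _
    · simp only [hk, if_false]
      refine (HasDerivAt.fun_add ?_ ?_).fun_sub ?_ <;> split_ifs <;>
        first | exact hβ _ | exact hasDerivAt_const _ _
  simp only [hΓ]
  set B := isotropicDenom κ q
  fin_cases k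
  · simp [hv0]
  · simp [Fin.sum_univ_four, hv0]
    field_simp
    linear_combination (-2 * κ * u 1) * huv
  · simp [Fin.sum_univ_four, hv0]
    field_simp
    linear_combination (-2 * κ * u 2) * huv
  · simp [Fin.sum_univ_four, hv0]
    field_simp
    linear_combination (-2 * κ * u 3) * huv

/-! ### Second derivatives along a curve and conformal rescaling. -/

theorem deriv_apply_eq {n : ℕ} {f : ℝ → Fin n → ℝ} {τ : ℝ} (h : DifferentiableAt ℝ f τ)
    (k : Fin n) : deriv f τ k = deriv (fun σ => f σ k) τ :=
  ((hasDerivAt_pi.1 h.hasDerivAt) k).deriv.symm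

theorem deriv_deriv_apply_eq {n : ℕ} {f : ℝ → Fin n → ℝ} {τ : ℝ} (h : ContDiffAt ℝ 2 f τ)
    (k : Fin n) : deriv (deriv f) τ k = deriv (deriv fun σ => f σ k) τ := by
  rw [deriv_apply_eq ((h.derivWithin (m := 1) (by norm_num)).differentiableAt (by norm_num))]
  refine Filter.EventuallyEq.deriv_eq ?_
  filter_upwards [h.eventually (by simp)] with σ hσ
  exact deriv_apply_eq (hσ.differentiableAt (by norm_num)) k

theorem ContDiffAt.hasDerivAt_deriv {f : ℝ → ℝ} {τ : ℝ} (h : ContDiffAt ℝ 2 f τ) :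
    HasDerivAt (deriv f) (deriv (deriv f) τ) τ :=
  ((h.derivWithin (m := 1) (by norm_num)).differentiableAt (by norm_num)).hasDerivAt

theorem deriv_deriv_mul {f g : ℝ → ℝ} {τ : ℝ} (hf : ContDiffAt ℝ 2 f τ)
    (hg : ContDiffAt ℝ 2 g τ) :
    deriv (deriv fun σ => f σ * g σ) τ =
      deriv (deriv f) τ * g τ + 2 * (deriv f τ * deriv g τ) + f τ * deriv (deriv g) τ := by
  have h : (deriv fun σ => f σ * g σ) =ᶠ[𝓝 τ] fun σ => deriv f σ * g σ + f σ * deriv g σ := by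
    filter_upwards [hf.eventually (by simp), hg.eventually (by simp)] with σ h1 h2
    exact deriv_fun_mul (h1.differentiableAt (by norm_num)) (h2.differentiableAt (by norm_num))
  rw [h.deriv_eq]
  have hf1 := (hf.differentiableAt (by norm_num)).hasDerivAt
  have hg1 := (hg.differentiableAt (by norm_num)).hasDerivAt
  have := ((hf.hasDerivAt_deriv.fun_mul hg1).fun_add (hf1.fun_mul hg.hasDerivAt_deriv)).deriv
  rw [this]
  ring

theorem deriv_isotropicDenom_comp {κ τ : ℝ} {y : ℝ → Fin 4 → ℝ} (hy : DifferentiableAt ℝ y τ) :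
    deriv (fun σ => isotropicDenom κ (y σ)) τ =
      κ / 2 * (y τ 1 * deriv y τ 1 + y τ 2 * deriv y τ 2 + y τ 3 * deriv y τ 3) := by
  have := ((differentiable_isotropicDenom κ (y τ)).hasFDerivAt.comp_hasDerivAt τ
    hy.hasDerivAt).deriv
  rw [fderiv_isotropicDenom] at this
  change deriv (isotropicDenom κ ∘ y) τ = _
  rw [this]
  ring

theorem contDiff_isotropicDenom (κ : ℝ) (n : WithTop ℕ∞) : ContDiff ℝ n (isotropicDenom κ) := by
  unfold isotropicDenom
  fun_prop

theorem deriv_deriv_isotropicDenom_comp {κ τ : ℝ} {y : ℝ → Fin 4 → ℝ}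
    (hy : ContDiffAt ℝ 2 y τ) :
    deriv (deriv fun σ => isotropicDenom κ (y σ)) τ =
      κ / 2 * (deriv y τ 1 ^ 2 + deriv y τ 2 ^ 2 + deriv y τ 3 ^ 2 + y τ 1 * deriv (deriv y) τ 1
        + y τ 2 * deriv (deriv y) τ 2 + y τ 3 * deriv (deriv y) τ 3) := by
  have h : (deriv fun σ => isotropicDenom κ (y σ)) =ᶠ[𝓝 τ] fun σ => κ / 2 *
      (y σ 1 * deriv y σ 1 + y σ 2 * deriv y σ 2 + y σ 3 * deriv y σ 3) := by
    filter_upwards [hy.eventually (by simp)] with σ h1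
    exact deriv_isotropicDenom_comp (h1.differentiableAt (by norm_num))
  have h1 := hasDerivAt_pi.1 (hy.differentiableAt (by norm_num)).hasDerivAt
  have h2 := hasDerivAt_pi.1 ((hy.derivWithin (m := 1) (by norm_num)).differentiableAt
    (by norm_num)).hasDerivAt
  rw [h.deriv_eq, (((((h1 1).fun_mul (h2 1)).fun_add ((h1 2).fun_mul (h2 2))).fun_add
    ((h1 3).fun_mul (h2 3))).const_mul (κ / 2)).deriv]
  ring

/-- Rescaling by the conformal denominator turns the spatial part of the geodesic operator in
isotropic coordinates into its counterpart in the ambient space. -/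
theorem isotropic_operator_mul {κ τ h : ℝ} {y : ℝ → Fin 4 → ℝ} {v : ℝ → ℝ}
    (hy : ContDiffAt ℝ 2 y τ) (hv : ContDiffAt ℝ 2 v τ) (hB : isotropicDenom κ (y τ) ≠ 0)
    (hgeo : ∀ k : Fin 4, k ≠ 0 → deriv (deriv y) τ k + 2 * h * deriv y τ k
      - κ / (2 * isotropicDenom κ (y τ)) *
        (2 * (y τ 1 * deriv y τ 1 + y τ 2 * deriv y τ 2 + y τ 3 * deriv y τ 3) * deriv y τ k
          - (deriv y τ 1 ^ 2 + deriv y τ 2 ^ 2 + deriv y τ 3 ^ 2) * y τ k) = 0) :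
    deriv (deriv fun σ => isotropicDenom κ (y σ) * v σ) τ
      + 2 * h * deriv (fun σ => isotropicDenom κ (y σ) * v σ) τ
      - κ / (2 * isotropicDenom κ (y τ)) *
        (2 * (y τ 1 * deriv y τ 1 + y τ 2 * deriv y τ 2 + y τ 3 * deriv y τ 3) *
            deriv (fun σ => isotropicDenom κ (y σ) * v σ) τ
          - (deriv y τ 1 ^ 2 + deriv y τ 2 ^ 2 + deriv y τ 3 ^ 2) *
            (isotropicDenom κ (y τ) * v τ))
      = isotropicDenom κ (y τ) * (deriv (deriv v) τ + 2 * h * deriv v τ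
        + κ * ((deriv y τ 1 ^ 2 + deriv y τ 2 ^ 2 + deriv y τ 3 ^ 2)
          / isotropicDenom κ (y τ) ^ 2) * v τ) := by
  have hb : ContDiffAt ℝ 2 (fun σ => isotropicDenom κ (y σ)) τ :=
    (contDiff_isotropicDenom κ 2).contDiffAt.comp τ hy
  rw [deriv_deriv_mul hb hv, deriv_fun_mul (hb.differentiableAt (by norm_num))
    (hv.differentiableAt (by norm_num)), deriv_isotropicDenom_comp
    (hy.differentiableAt (by norm_num)), deriv_deriv_isotropicDenom_comp hy]
  have g1 := hgeo 1 (by decide)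
  have g2 := hgeo 2 (by decide)
  have g3 := hgeo 3 (by decide)
  have hBdef : isotropicDenom κ (y τ) = 1 + κ * (y τ 1 ^ 2 + y τ 2 ^ 2 + y τ 3 ^ 2) / 4 := rfl
  generalize isotropicDenom κ (y τ) = B at *
  generalize deriv (deriv y) τ = w at *
  generalize deriv y τ = u at *
  generalize y τ = z at *
  -- The geodesic equation eliminates the second derivatives of `y`, which enter through the second
  -- derivative of the denominator. What is then left is a multiple of `B = 1 + κ |z|² / 4`.
  have e : ∀ k, w k + 2 * h * u k - κ / (2 * B) * (2 * (z 1 * u 1 + z 2 * u 2 + z 3 * u 3) * u k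
      - (u 1 ^ 2 + u 2 ^ 2 + u 3 ^ 2) * z k) = 0 → w k = -2 * h * u k + κ / (2 * B) *
      (2 * (z 1 * u 1 + z 2 * u 2 + z 3 * u 3) * u k
      - (u 1 ^ 2 + u 2 ^ 2 + u 3 ^ 2) * z k) := fun k hk => by linarith
  rw [e 1 g1, e 2 g2, e 3 g3]
  field_simp
  linear_combination (4 * κ * v τ * (u 1 ^ 2 + u 2 ^ 2 + u 3 ^ 2)) * hBdef

/-! ### The geodesic equation in the charts and in the ambient space. -/

theorem isOpen_flrwTimes (t₀ : ℝ) (tf : EReal) : IsOpen (flrwTimes t₀ tf) :=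
  isOpen_Ioi.inter (isOpen_Iio.preimage continuous_coe_real_ereal)

theorem contDiffAt_flrwChart {s : ℝ} {p : Fin 5 → ℝ} (hd : 0 < 1 + s * p 4) (n : WithTop ℕ∞) :
    ContDiffAt ℝ n (flrwChart s) p := by
  rw [contDiffAt_pi]
  have hp : ∀ i : Fin 5, ContDiffAt ℝ n (fun q : Fin 5 → ℝ => q i) p := fun i =>
    (contDiff_apply ℝ ℝ i).contDiffAt
  have hden : ContDiffAt ℝ n (fun q : Fin 5 → ℝ => 1 + s * q 4) p :=
    contDiffAt_const.add (contDiffAt_const.mul (hp 4))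
  have hq : ∀ i : Fin 5, ContDiffAt ℝ n (fun q : Fin 5 → ℝ => 2 * q i / (1 + s * q 4)) p :=
    fun i => (contDiffAt_const.mul (hp i)).div hden hd.ne'
  intro k
  fin_cases k
  · exact hp 0
  · exact hq 1
  · exact hq 2
  · exact hq 3

/-- With `s² = 1` and `κ |x|² = 1 - w²`, the numerator `(1 + s w)² + κ |x|²` collapses to `2 (1 + s
w)`. -/
theorem isotropicDenom_flrwChart {κ t₀ s : ℝ} {tf : EReal} {p : Fin 5 → ℝ}
    (hp : p ∈ flrwSpacetime κ t₀ tf) (hs : s = 1 ∨ s = -1) (hd : 0 < 1 + s * p 4) :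
    isotropicDenom κ (flrwChart s p) = 2 / (1 + s * p 4) := by
  have hs2 : s ^ 2 = 1 := by rcases hs with rfl | rfl <;> norm_num
  have hne := hd.ne'
  change 1 + κ * ((2 * p 1 / (1 + s * p 4)) ^ 2 + (2 * p 2 / (1 + s * p 4)) ^ 2 +
      (2 * p 3 / (1 + s * p 4)) ^ 2) / 4 = 2 / (1 + s * p 4)
  field_simp
  linear_combination 4 * hp.2.1 + 4 * p 4 ^ 2 * hs2

/-- This relation `y = B x`, `B` the conformal denominator, is the reason why multiplication by `B`
carries ambient linear equations into the chart. -/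
theorem flrwChart_spatial {κ t₀ s : ℝ} {tf : EReal} {p : Fin 5 → ℝ}
    (hp : p ∈ flrwSpacetime κ t₀ tf) (hs : s = 1 ∨ s = -1) (hd : 0 < 1 + s * p 4)
    {k : Fin 4} (hk : k ≠ 0) :
    flrwChart s p k = isotropicDenom κ (flrwChart s p) * p k.castSucc := by
  rw [isotropicDenom_flrwChart hp hs hd]
  fin_cases k
  · exact absurd rfl hk
  all_goals
    simp [flrwChart]
    ring

theorem exists_chart_sign (w : ℝ) : ∃ s : ℝ, (s = 1 ∨ s = -1) ∧ 0 < 1 + s * w := by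
  rcases le_total 0 w with h | h
  · exact ⟨1, Or.inl rfl, by linarith⟩
  · exact ⟨-1, Or.inr rfl, by linarith⟩

namespace IsFLRWGeodesic

variable {κ t₀ : ℝ} {a : ℝ → ℝ} {tf : EReal} {I : Set ℝ} {γ : ℝ → Fin 5 → ℝ}

theorem contDiffAt (hγ : IsFLRWGeodesic κ a t₀ tf I γ) (hI : IsOpen I) {τ : ℝ} (hτ : τ ∈ I) :
    ContDiffAt ℝ (⊤ : ℕ∞) γ τ :=
  hγ.smooth.contDiffAt (hI.mem_nhds hτ)

theorem contDiffAt_two (hγ : IsFLRWGeodesic κ a t₀ tf I γ) (hI : IsOpen I) {τ : ℝ} (hτ : τ ∈ I) :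
    ContDiffAt ℝ 2 γ τ :=
  contDiffAt_infty.1 (hγ.contDiffAt hI hτ) 2

theorem hasDerivAt_apply (hγ : IsFLRWGeodesic κ a t₀ tf I γ) (hI : IsOpen I) {τ : ℝ}
    (hτ : τ ∈ I) (i : Fin 5) : HasDerivAt (fun σ => γ σ i) (deriv γ τ i) τ :=
  hasDerivAt_pi.1 ((hγ.contDiffAt_two hI hτ).differentiableAt (by norm_num)).hasDerivAt i

theorem tangent_deriv (hγ : IsFLRWGeodesic κ a t₀ tf I γ) (hI : IsOpen I) {τ : ℝ} (hτ : τ ∈ I) :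
    flrwTangent κ (γ τ) (deriv γ τ) := by
  have h := hγ.hasDerivAt_apply hI hτ
  have h1 := (((h 4).fun_pow 2).fun_add (((((h 1).fun_pow 2).fun_add ((h 2).fun_pow 2)).fun_add
    ((h 3).fun_pow 2)).const_mul κ))
  have h2 : (fun σ => γ σ 4 ^ 2 + κ * (γ σ 1 ^ 2 + γ σ 2 ^ 2 + γ σ 3 ^ 2)) =ᶠ[𝓝 τ]
      fun _ => (1 : ℝ) := by
    filter_upwards [hI.mem_nhds hτ] with σ hσ using (hγ.mapsTo hσ).2.1
  have h3 := h1.unique ((hasDerivAt_const τ (1 : ℝ)).congr_of_eventuallyEq h2)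
  unfold flrwTangent
  norm_num at h3
  linarith

theorem eventually_chart (hγ : IsFLRWGeodesic κ a t₀ tf I γ) (hI : IsOpen I) {τ s : ℝ}
    (hτ : τ ∈ I) (hd : 0 < 1 + s * γ τ 4) : ∀ᶠ σ in 𝓝 τ, σ ∈ I ∧ 0 < 1 + s * γ σ 4 := by
  have h : ContinuousAt (fun σ => 1 + s * γ σ 4) τ :=
    continuousAt_const.add (continuousAt_const.mul (hγ.hasDerivAt_apply hI hτ 4).continuousAt)
  exact (hI.eventually_mem hτ).and (h.eventually (lt_mem_nhds hd))

theorem contDiffAt_chart (hγ : IsFLRWGeodesic κ a t₀ tf I γ) (hI : IsOpen I) {τ s : ℝ}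
    (hτ : τ ∈ I) (hd : 0 < 1 + s * γ τ 4) : ContDiffAt ℝ 2 (flrwChart s ∘ γ) τ :=
  (contDiffAt_flrwChart hd 2).comp τ (hγ.contDiffAt_two hI hτ)

theorem deriv_chart (hγ : IsFLRWGeodesic κ a t₀ tf I γ) (hI : IsOpen I) {τ s : ℝ}
    (hτ : τ ∈ I) (hd : 0 < 1 + s * γ τ 4) :
    deriv (flrwChart s ∘ γ) τ = fderiv ℝ (flrwChart s) (γ τ) (deriv γ τ) :=
  (((contDiffAt_flrwChart hd 2).differentiableAt (by norm_num)).hasFDerivAt.comp_hasDerivAt τ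
    ((hγ.contDiffAt_two hI hτ).differentiableAt (by norm_num)).hasDerivAt).deriv

theorem isotropicDenom_ne_zero (hγ : IsFLRWGeodesic κ a t₀ tf I γ) {τ s : ℝ}
    (hτ : τ ∈ I) (hs : s = 1 ∨ s = -1) (hd : 0 < 1 + s * γ τ 4) :
    isotropicDenom κ ((flrwChart s ∘ γ) τ) ≠ 0 := by
  rw [Function.comp, isotropicDenom_flrwChart (hγ.mapsTo hτ) hs hd]
  positivity

/-- The isometry property of the chart, applied with scale factor `1`; the time parts cancel. -/
theorem chart_speed (hγ : IsFLRWGeodesic κ a t₀ tf I γ) (hI : IsOpen I) {τ s : ℝ}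
    (hτ : τ ∈ I) (hs : s = 1 ∨ s = -1) (hd : 0 < 1 + s * γ τ 4) :
    (deriv (flrwChart s ∘ γ) τ 1 ^ 2 + deriv (flrwChart s ∘ γ) τ 2 ^ 2
      + deriv (flrwChart s ∘ γ) τ 3 ^ 2) / isotropicDenom κ ((flrwChart s ∘ γ) τ) ^ 2
      = spatialInner κ (deriv γ τ) (deriv γ τ) := by
  have h := flrwMetric_chart (fun _ => 1) (hγ.mapsTo hτ) hs hd (hγ.tangent_deriv hI hτ)
    (hγ.tangent_deriv hI hτ)
  have h0 : fderiv ℝ (flrwChart s) (γ τ) (deriv γ τ) 0 = deriv γ τ 0 := by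
    rw [flrwChart_fderiv hd]; rfl
  simp only [flrwMetric, flrwInner, Matrix.diagonal_apply, ite_mul,
    zero_mul, Finset.sum_ite_eq, Finset.mem_univ, if_true, Fin.sum_univ_four, h0] at h
  simp only [show (1 : Fin 4) ≠ 0 by decide, show (2 : Fin 4) ≠ 0 by decide,
    show (3 : Fin 4) ≠ 0 by decide, if_false, one_pow, one_mul] at h
  rw [hγ.deriv_chart hI hτ hd]
  change _ / (1 + κ * (flrwChart s (γ τ) 1 ^ 2 + flrwChart s (γ τ) 2 ^ 2 +
    flrwChart s (γ τ) 3 ^ 2) / 4) ^ 2 = _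
  linear_combination h

theorem contDiffAt_scale (hγ : IsFLRWGeodesic κ a t₀ tf I γ)
    (ha : ContDiffOn ℝ (⊤ : ℕ∞) a (flrwTimes t₀ tf)) {τ : ℝ} (hτ : τ ∈ I) :
    ContDiffAt ℝ 2 a (γ τ 0) :=
  contDiffAt_infty.1 (ha.contDiffAt ((isOpen_flrwTimes t₀ tf).mem_nhds (hγ.mapsTo hτ).1)) 2

theorem chart_time (hγ : IsFLRWGeodesic κ a t₀ tf I γ) (hI : IsOpen I)
    (ha_pos : ∀ t ∈ flrwTimes t₀ tf, 0 < a t)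
    (ha : ContDiffOn ℝ (⊤ : ℕ∞) a (flrwTimes t₀ tf)) {τ s : ℝ}
    (hτ : τ ∈ I) (hs : s = 1 ∨ s = -1) (hd : 0 < 1 + s * γ τ 4) :
    deriv (deriv (flrwChart s ∘ γ)) τ 0 + a (γ τ 0) * deriv a (γ τ 0)
      * spatialInner κ (deriv γ τ) (deriv γ τ) = 0 := by
  have h := congrFun (hγ.geodesic_eq s hs τ hτ hd) 0
  have hB := hγ.isotropicDenom_ne_zero hτ hs hd
  have h0 : (flrwChart s ∘ γ) τ 0 = γ τ 0 := rfl
  have ha2 := hγ.contDiffAt_scale ha hτ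
  simp only [covDeriv, Pi.zero_apply, christoffel_flrwMetric (q := (flrwChart s ∘ γ) τ)
    (ha2.differentiableAt (by norm_num)) hB (ha_pos _ (hγ.mapsTo hτ).1).ne',
    sum_flrwGamma_zero, h0] at h
  rw [← hγ.chart_speed hI hτ hs hd, ← h]
  ring

theorem chart_spatial (hγ : IsFLRWGeodesic κ a t₀ tf I γ) (hI : IsOpen I)
    (ha_pos : ∀ t ∈ flrwTimes t₀ tf, 0 < a t)
    (ha : ContDiffOn ℝ (⊤ : ℕ∞) a (flrwTimes t₀ tf)) {τ s : ℝ}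
    (hτ : τ ∈ I) (hs : s = 1 ∨ s = -1) (hd : 0 < 1 + s * γ τ 4) (k : Fin 4) (hk : k ≠ 0) :
    deriv (deriv (flrwChart s ∘ γ)) τ k
      + 2 * (deriv a (γ τ 0) / a (γ τ 0) * deriv γ τ 0) * deriv (flrwChart s ∘ γ) τ k
      - κ / (2 * isotropicDenom κ ((flrwChart s ∘ γ) τ)) *
        (2 * ((flrwChart s ∘ γ) τ 1 * deriv (flrwChart s ∘ γ) τ 1
          + (flrwChart s ∘ γ) τ 2 * deriv (flrwChart s ∘ γ) τ 2
          + (flrwChart s ∘ γ) τ 3 * deriv (flrwChart s ∘ γ) τ 3) * deriv (flrwChart s ∘ γ) τ k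
        - (deriv (flrwChart s ∘ γ) τ 1 ^ 2 + deriv (flrwChart s ∘ γ) τ 2 ^ 2
          + deriv (flrwChart s ∘ γ) τ 3 ^ 2) * (flrwChart s ∘ γ) τ k) = 0 := by
  have h := congrFun (hγ.geodesic_eq s hs τ hτ hd) k
  have hB := hγ.isotropicDenom_ne_zero hτ hs hd
  have h0 : (flrwChart s ∘ γ) τ 0 = γ τ 0 := rfl
  have h1 : deriv (flrwChart s ∘ γ) τ 0 = deriv γ τ 0 := by
    rw [hγ.deriv_chart hI hτ hd, flrwChart_fderiv hd]; rfl
  have ha2 := hγ.contDiffAt_scale ha hτ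
  simp only [covDeriv, Pi.zero_apply, christoffel_flrwMetric (q := (flrwChart s ∘ γ) τ)
    (ha2.differentiableAt (by norm_num)) hB (ha_pos _ (hγ.mapsTo hτ).1).ne',
    sum_flrwGamma_spatial _ _ _ _ _ hk, h0, h1] at h
  rw [← h]
  ring

/-- The time component of the geodesic equation. -/
theorem time_eq (hγ : IsFLRWGeodesic κ a t₀ tf I γ) (hI : IsOpen I)
    (ha_pos : ∀ t ∈ flrwTimes t₀ tf, 0 < a t)
    (ha : ContDiffOn ℝ (⊤ : ℕ∞) a (flrwTimes t₀ tf)) {τ : ℝ} (hτ : τ ∈ I) :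
    deriv (deriv fun σ => γ σ 0) τ + a (γ τ 0) * deriv a (γ τ 0)
      * spatialInner κ (deriv γ τ) (deriv γ τ) = 0 := by
  obtain ⟨s, hs, hd⟩ := exists_chart_sign (γ τ 4)
  rw [← hγ.chart_time hI ha_pos ha hτ hs hd, deriv_deriv_apply_eq (hγ.contDiffAt_chart hI hτ hd)]
  rfl

/-- The spatial components of the geodesic equation in the ambient space of `Σ_κ`. -/
theorem space_eq (hγ : IsFLRWGeodesic κ a t₀ tf I γ) (hI : IsOpen I)
    (ha_pos : ∀ t ∈ flrwTimes t₀ tf, 0 < a t)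
    (ha : ContDiffOn ℝ (⊤ : ℕ∞) a (flrwTimes t₀ tf)) {τ : ℝ} (hτ : τ ∈ I)
    (k : Fin 4) (hk : k ≠ 0) :
    deriv (deriv fun σ => γ σ k.castSucc) τ
      + 2 * (deriv a (γ τ 0) / a (γ τ 0) * deriv γ τ 0) * deriv (fun σ => γ σ k.castSucc) τ
      + κ * spatialInner κ (deriv γ τ) (deriv γ τ) * γ τ k.castSucc = 0 := by
  obtain ⟨s, hs, hd⟩ := exists_chart_sign (γ τ 4)
  have hy := hγ.contDiffAt_chart hI hτ hd
  have hB := hγ.isotropicDenom_ne_zero hτ hs hd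
  have hv : ContDiffAt ℝ 2 (fun σ => γ σ k.castSucc) τ :=
    contDiffAt_pi.1 (hγ.contDiffAt_two hI hτ) _
  -- For `v = x_k` the product `B v` is the chart coordinate `y_k`, so the left side is the chart
  -- geodesic equation and vanishes. Dividing by `B ≠ 0` leaves the ambient equation.
  have h := isotropic_operator_mul hy hv hB (hγ.chart_spatial hI ha_pos ha hτ hs hd)
  have hev : (fun σ => isotropicDenom κ ((flrwChart s ∘ γ) σ) * γ σ k.castSucc) =ᶠ[𝓝 τ]
      fun σ => (flrwChart s ∘ γ) σ k := by
    filter_upwards [hγ.eventually_chart hI hτ hd] with σ hσ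
    exact (flrwChart_spatial (hγ.mapsTo hσ.1) hs hσ.2 hk).symm
  rw [hev.deriv.deriv_eq, hev.deriv_eq, hev.eq_of_nhds,
    ← deriv_deriv_apply_eq hy, ← deriv_apply_eq (hy.differentiableAt (by norm_num)),
    hγ.chart_spatial hI ha_pos ha hτ hs hd k hk, hγ.chart_speed hI hτ hs hd] at h
  exact (mul_eq_zero.1 h.symm).resolve_left hB

end IsFLRWGeodesic

/-! ### Jacobi fields normal to a totally geodesic hypersurface. -/

/-- The field `ψ e` along a curve in the ambient space, where `e ∈ ℝ³` is constant. -/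
def ambientField (ψ : ℝ → ℝ) (e : Fin 3 → ℝ) (τ : ℝ) : Fin 5 → ℝ :=
  ![0, ψ τ * e 0, ψ τ * e 1, ψ τ * e 2, 0]

namespace IsFLRWGeodesic

variable {κ t₀ : ℝ} {a : ℝ → ℝ} {tf : EReal} {I : Set ℝ} {γ : ℝ → Fin 5 → ℝ}

/-- If `γ` lies in the totally geodesic hypersurface `e · x = 0`, then a multiple `ψ e` of its
normal is a Jacobi field as soon as `ψ` solves the equation of the spatial coordinates of `γ`. -/
theorem isJacobiField_ambientField (hγ : IsFLRWGeodesic κ a t₀ tf I γ) (hI : IsOpen I)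
    (ha_pos : ∀ t ∈ flrwTimes t₀ tf, 0 < a t)
    (ha : ContDiffOn ℝ (⊤ : ℕ∞) a (flrwTimes t₀ tf)) {ψ : ℝ → ℝ} {e : Fin 3 → ℝ}
    (hψ : ContDiffOn ℝ (⊤ : ℕ∞) ψ I)
    (he : ∀ τ ∈ I, γ τ 1 * e 0 + γ τ 2 * e 1 + γ τ 3 * e 2 = 0)
    (hode : ∀ τ ∈ I, deriv (deriv ψ) τ
      + 2 * (deriv a (γ τ 0) / a (γ τ 0) * deriv γ τ 0) * deriv ψ τ
      + κ * spatialInner κ (deriv γ τ) (deriv γ τ) * ψ τ = 0) :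
    IsJacobiField κ a I γ (ambientField ψ e) where
  smooth := by
    rw [contDiffOn_pi]
    intro k
    fin_cases k
    · exact contDiffOn_const
    · exact hψ.mul contDiffOn_const
    · exact hψ.mul contDiffOn_const
    · exact hψ.mul contDiffOn_const
    · exact contDiffOn_const
  tangent := by
    intro τ hτ
    simp only [flrwTangent, ambientField, Matrix.cons_val]
    linear_combination κ * ψ τ * he τ hτ
  jacobi_eq := by
    intro s hs τ hτ hd
    have hy := hγ.contDiffAt_chart hI hτ hd
    have hB := hγ.isotropicDenom_ne_zero hτ hs hd
    have ha2 := hγ.contDiffAt_scale ha hτ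
    have ha0 := (ha_pos _ (hγ.mapsTo hτ).1).ne'
    have hψ2 : ContDiffAt ℝ 2 ψ τ := contDiffAt_infty.1 (hψ.contDiffAt (hI.mem_nhds hτ)) 2
    set c := flrwChart s ∘ γ with hc
    set χ : ℝ → ℝ := fun σ => isotropicDenom κ (c σ) * ψ σ with hχ
    have hχ2 : ContDiffAt ℝ 2 χ τ :=
      ((contDiff_isotropicDenom κ 2).contDiffAt.comp τ hy).mul hψ2
    set W : ℝ → Fin 4 → ℝ := fun σ k => χ σ * (![0, e 0, e 1, e 2] : Fin 4 → ℝ) k with hW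
    have hW2 : ContDiffAt ℝ 2 W τ := contDiffAt_pi.2 fun k => hχ2.mul contDiffAt_const
    -- The field has no `w`-component, so the chart differential merely multiplies it by `2 / (1 + s
    -- w) = B`: its chart components are `B ψ` times a constant vector.
    have hVW : chartField s γ (ambientField ψ e) =ᶠ[𝓝 τ] W := by
      filter_upwards [hγ.eventually_chart hI hτ hd] with σ hσ
      rw [chartField, flrwChart_fderiv hσ.2]
      simp only [hW, hχ, hc, Function.comp, isotropicDenom_flrwChart (hγ.mapsTo hσ.1) hs hσ.2]
      funext k
      fin_cases k <;> simp [ambientField] <;> ring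
    have hV2 : ContDiffAt ℝ 2 (chartField s γ (ambientField ψ e)) τ := hW2.congr_of_eventuallyEq hVW
    have hy1 := hasDerivAt_pi.1 (hy.differentiableAt (by norm_num)).hasDerivAt
    have hcσ : ∀ᶠ σ in 𝓝 τ, c σ 1 * e 0 + c σ 2 * e 1 + c σ 3 * e 2 = 0 := by
      filter_upwards [hγ.eventually_chart hI hτ hd] with σ hσ
      have h := fun k hk => flrwChart_spatial (hγ.mapsTo hσ.1) hs hσ.2 (k := k) hk
      change flrwChart s (γ σ) 1 * _ + flrwChart s (γ σ) 2 * _ + flrwChart s (γ σ) 3 * _ = 0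
      rw [h 1 (by decide), h 2 (by decide), h 3 (by decide)]
      have := he σ hσ.1
      change isotropicDenom κ (flrwChart s (γ σ)) * γ σ 1 * e 0 +
        isotropicDenom κ (flrwChart s (γ σ)) * γ σ 2 * e 1 +
        isotropicDenom κ (flrwChart s (γ σ)) * γ σ 3 * e 2 = 0
      linear_combination isotropicDenom κ (flrwChart s (γ σ)) * this
    have huσ : deriv c τ 1 * e 0 + deriv c τ 2 * e 1 + deriv c τ 3 * e 2 = 0 :=
      ((((hy1 1).mul_const (e 0)).fun_add ((hy1 2).mul_const (e 1))).fun_add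
        ((hy1 3).mul_const (e 2))).unique
        ((hasDerivAt_const τ (0 : ℝ)).congr_of_eventuallyEq hcσ)
    have hW1 : ∀ k, deriv W τ k = deriv χ τ * (![0, e 0, e 1, e 2] : Fin 4 → ℝ) k := fun k => by
      rw [deriv_apply_eq (hW2.differentiableAt (by norm_num))]
      exact ((hχ2.differentiableAt (by norm_num)).hasDerivAt.mul_const _).deriv
    have hW11 : ∀ k, deriv (deriv W) τ k =
        deriv (deriv χ) τ * (![0, e 0, e 1, e 2] : Fin 4 → ℝ) k := fun k => by
      rw [deriv_deriv_apply_eq hW2]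
      have : deriv (fun σ => W σ k) =ᶠ[𝓝 τ]
          fun σ => deriv χ σ * (![0, e 0, e 1, e 2] : Fin 4 → ℝ) k := by
        filter_upwards [hχ2.eventually (by simp)] with σ hσ
        exact ((hσ.differentiableAt (by norm_num)).hasDerivAt.mul_const _).deriv
      rw [this.deriv_eq]
      exact (hχ2.hasDerivAt_deriv.mul_const _).deriv
    -- The equation for `ψ` makes the right side zero, which leaves the scalar equation for `χ = B
    -- ψ` in the chart.
    have hop := isotropic_operator_mul hy hψ2 hB (hγ.chart_spatial hI ha_pos ha hτ hs hd)
    rw [hγ.chart_speed hI hτ hs hd, hode τ hτ, mul_zero] at hop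
    have h0 : c τ 0 = γ τ 0 := rfl
    have h1 : deriv c τ 0 = deriv γ τ 0 := by
      rw [hγ.deriv_chart hI hτ hd, flrwChart_fderiv hd]; rfl
    have hC : ∀ k i j, christoffel (flrwMetric κ a) k i j (c τ) = flrwGamma κ a k i j (c τ) :=
      christoffel_flrwMetric (ha2.differentiableAt (by norm_num)) hB ha0
    funext k
    have hv0 : W τ 0 = 0 := by simp [hW]
    have hgeo : covDeriv (flrwMetric κ a) c (deriv c) τ = 0 := hγ.geodesic_eq s hs τ hτ hd
    rw [covDeriv_covDeriv_add_curvatureAlong (christoffel_flrwMetric_symm κ a)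
      (differentiableAt_christoffel_flrwMetric ha2 hB ha0) hy hV2 k, hVW.deriv.deriv_eq,
      hVW.deriv_eq, hVW.eq_of_nhds, hgeo, sum_fderiv_christoffel_flrwMetric ha2 hB ha0 hv0
        (by simp only [hW, Matrix.cons_val]; linear_combination χ τ * hcσ.self_of_nhds)
        (by simp only [hW, Matrix.cons_val]; linear_combination χ τ * huσ)]
    simp only [hC, Pi.zero_apply, mul_zero, zero_mul, Finset.sum_const_zero, add_zero, hW11]
    -- In the time component only a multiple of `u · e = 0` remains. The spatial components are `E
    -- k` times the equation for `χ`, plus multiples of `y · e` and `u · e`, which vanish.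
    by_cases hk : k = 0
    · subst hk
      rw [sum_flrwGamma_zero]
      simp only [hW1]
      simp only [hW, Matrix.cons_val]
      linear_combination 2 * (a (c τ 0) * deriv a (c τ 0) / isotropicDenom κ (c τ) ^ 2) *
        deriv χ τ * huσ
    · rw [sum_flrwGamma_spatial _ _ _ _ _ hk, h0, h1]
      simp only [hW1]
      simp only [hW]
      generalize hG : (![0, e 0, e 1, e 2] : Fin 4 → ℝ) = E
      have hE0 : E 0 = 0 := by rw [← hG]; rfl
      have hE1 : E 1 = e 0 := by rw [← hG]; rfl
      have hE2 : E 2 = e 1 := by rw [← hG]; rfl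
      have hE3 : E 3 = e 2 := by rw [← hG]; rfl
      rw [hE0, hE1, hE2, hE3]
      linear_combination E k * hop - (κ / isotropicDenom κ (c τ)) * deriv χ τ * deriv c τ k *
        hcσ.self_of_nhds + (κ / isotropicDenom κ (c τ)) * deriv χ τ * c τ k * huσ

end IsFLRWGeodesic

/-! ### Generalised sine and cosine. -/

/-- The solution of `y'' + κ y = 0`, `y(0) = 0`, `y'(0) = 1`. -/
noncomputable def curvSin (κ x : ℝ) : ℝ :=
  if 0 < κ then Real.sin (√κ * x) / √κ else if κ = 0 then x else Real.sinh (√(-κ) * x) / √(-κ)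

/-- The solution of `y'' + κ y = 0`, `y(0) = 1`, `y'(0) = 0`. -/
noncomputable def curvCos (κ x : ℝ) : ℝ :=
  if 0 < κ then Real.cos (√κ * x) else if κ = 0 then 1 else Real.cosh (√(-κ) * x)

/-- Writing `κ = ±r²` removes the square roots and the case distinctions, so identities need only be
checked on elementary functions. -/
theorem curv_cases {P : ℝ → (ℝ → ℝ) → (ℝ → ℝ) → Prop}
    (hpos : ∀ r : ℝ, 0 < r → P (r ^ 2) (fun x => Real.sin (r * x) / r) fun x => Real.cos (r * x))
    (hzero : P 0 (fun x => x) fun _ => 1)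
    (hneg : ∀ r : ℝ, 0 < r →
      P (-r ^ 2) (fun x => Real.sinh (r * x) / r) fun x => Real.cosh (r * x)) (κ : ℝ) :
    P κ (curvSin κ) (curvCos κ) := by
  rcases lt_trichotomy 0 κ with h | h | h
  · have := hpos (√κ) (Real.sqrt_pos.2 h)
    rw [Real.sq_sqrt h.le] at this
    convert this using 1 <;> (funext x; simp [curvSin, curvCos, h])
  · subst h
    convert hzero using 1 <;> (funext x; simp [curvSin, curvCos])
  · have := hneg (√(-κ)) (Real.sqrt_pos.2 (by linarith))
    rw [Real.sq_sqrt (by linarith), neg_neg] at this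
    convert this using 1 <;> (funext x; simp [curvSin, curvCos, not_lt.2 h.le, h.ne])

theorem hasDerivAt_curvSin (κ x : ℝ) : HasDerivAt (curvSin κ) (curvCos κ x) x := by
  refine curv_cases (P := fun κ S C => HasDerivAt S (C x) x) (fun r hr => ?_) (hasDerivAt_id x)
    (fun r hr => ?_) κ
  · convert! (((hasDerivAt_id x).const_mul r).sin).div_const r using 1
    field_simp; rfl
  · convert! (((hasDerivAt_id x).const_mul r).sinh).div_const r using 1
    field_simp; rfl

theorem hasDerivAt_curvCos (κ x : ℝ) : HasDerivAt (curvCos κ) (-κ * curvSin κ x) x := by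
  refine curv_cases (P := fun κ S C => HasDerivAt C (-κ * S x) x) (fun r hr => ?_) ?_
    (fun r hr => ?_) κ
  · convert! ((hasDerivAt_id x).const_mul r).cos using 1
    simp only [id]
    field_simp
  · simpa using hasDerivAt_const x (1 : ℝ)
  · convert! ((hasDerivAt_id x).const_mul r).cosh using 1
    simp only [id]
    field_simp

theorem curvCos_sq_add (κ x : ℝ) : curvCos κ x ^ 2 + κ * curvSin κ x ^ 2 = 1 := by
  refine curv_cases (P := fun κ S C => C x ^ 2 + κ * S x ^ 2 = 1) (fun r hr => ?_) (by simp)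
    (fun r hr => ?_) κ
  · field_simp
    linarith [Real.sin_sq_add_cos_sq (r * x)]
  · field_simp
    linarith [Real.cosh_sq (r * x)]

theorem contDiff_curvSin (κ : ℝ) (n : WithTop ℕ∞) : ContDiff ℝ n (curvSin κ) := by
  refine curv_cases (P := fun _ S _ => ContDiff ℝ n S) (fun r hr => ?_) contDiff_id
    (fun r hr => ?_) κ
  · exact (Real.contDiff_sin.comp (contDiff_const.mul contDiff_id)).div_const r
  · exact (Real.contDiff_sinh.comp (contDiff_const.mul contDiff_id)).div_const r

theorem curvSin_zero (κ : ℝ) : curvSin κ 0 = 0 :=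
  curv_cases (P := fun _ S _ => S 0 = 0) (by simp) rfl (by simp) κ

theorem curvCos_zero (κ : ℝ) : curvCos κ 0 = 1 :=
  curv_cases (P := fun _ _ C => C 0 = 1) (by simp) rfl (by simp) κ

theorem abs_curvSin_le_of_pos {κ : ℝ} (hκ : 0 < κ) (x : ℝ) : |curvSin κ x| ≤ 1 / √κ := by
  rw [curvSin, if_pos hκ, abs_div, abs_of_pos (Real.sqrt_pos.2 hκ)]
  gcongr
  exact Real.abs_sin_le_one _

theorem curvCos_pos_of_nonpos {κ : ℝ} (hκ : κ ≤ 0) (x : ℝ) : 0 < curvCos κ x := by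
  rw [curvCos, if_neg (not_lt.2 hκ)]
  split_ifs
  · exact one_pos
  · exact Real.cosh_pos _

theorem curvSin_mono_of_nonpos {κ : ℝ} (hκ : κ ≤ 0) : Monotone (curvSin κ) :=
  monotone_of_hasDerivAt_nonneg (hasDerivAt_curvSin κ) fun x => (curvCos_pos_of_nonpos hκ x).le

theorem curvSin_neg (κ x : ℝ) : curvSin κ (-x) = -curvSin κ x :=
  curv_cases (P := fun _ S _ => S (-x) = -S x) (by simp [neg_div]) rfl (by simp [neg_div]) κ

theorem abs_curvSin_le_of_nonpos {κ : ℝ} (hκ : κ ≤ 0) {x y : ℝ} (h : |x| ≤ y) :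
    |curvSin κ x| ≤ curvSin κ y := by
  rw [abs_le] at h ⊢
  rw [← curvSin_neg]
  exact ⟨curvSin_mono_of_nonpos hκ h.1, curvSin_mono_of_nonpos hκ h.2⟩

/-! ### Conformal time and the Riccati estimate near the singularity. -/

theorem ordConnected_flrwTimes (t₀ : ℝ) (tf : EReal) : (flrwTimes t₀ tf).OrdConnected :=
  ⟨fun _ hx _ hy _ hz => ⟨hx.1.trans_le hz.1,
    (EReal.coe_le_coe_iff.2 hz.2).trans_lt hy.2⟩⟩

theorem hasDerivAt_integral_left {g : ℝ → ℝ} {S : Set ℝ} (hS : IsOpen S) (hS' : S.OrdConnected)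
    (hg : ContinuousOn g S) {t b : ℝ} (ht : t ∈ S) (hb : b ∈ S) :
    HasDerivAt (fun x => ∫ y in x..b, g y) (-g t) t :=
  intervalIntegral.integral_hasDerivAt_left
    ((hg.mono (hS'.uIcc_subset ht hb)).intervalIntegrable)
    (hg.stronglyMeasurableAtFilter hS t ht) (hg.continuousAt (hS.mem_nhds ht))

theorem continuousOn_curvatureTerm {κ t₀ : ℝ} {tf : EReal} {a : ℝ → ℝ}
    (ha_pos : ∀ t ∈ flrwTimes t₀ tf, 0 < a t)
    (ha : ContDiffOn ℝ (⊤ : ℕ∞) a (flrwTimes t₀ tf)) :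
    ContinuousOn (curvatureTerm κ a) (flrwTimes t₀ tf) := by
  have hO := isOpen_flrwTimes t₀ tf
  have h1 : ContDiffOn ℝ (⊤ : ℕ∞) (deriv a) (flrwTimes t₀ tf) :=
    ((contDiffOn_infty_iff_deriv_of_isOpen hO).1 ha).2
  have h2 : ContDiffOn ℝ (⊤ : ℕ∞) (deriv (deriv a)) (flrwTimes t₀ tf) :=
    ((contDiffOn_infty_iff_deriv_of_isOpen hO).1 h1).2
  have c0 := ha.continuousOn
  have c1 := h1.continuousOn
  have c2 := h2.continuousOn
  have hne : ∀ t ∈ flrwTimes t₀ tf, a t ≠ 0 := fun t ht => (ha_pos t ht).ne'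
  have hne2 : ∀ t ∈ flrwTimes t₀ tf, a t ^ 2 ≠ 0 := fun t ht => pow_ne_zero 2 (hne t ht)
  exact (continuousOn_const.div c0 hne).mul (((c2.div c0 hne).sub
    ((c1.pow 2).div (c0.pow 2) hne2)).sub (continuousOn_const.div (c0.pow 2) hne2))

/-- If the double integral of the curvature term diverges, the transversal null Jacobi field
`a sn_κ(η)`, `η` the conformal time, tends to zero at the singularity. -/
theorem tendsto_scale_mul_curvSin {κ t₀ : ℝ} {tf : EReal} {a : ℝ → ℝ} (hκ : κ ≤ 0)
    (ha_pos : ∀ t ∈ flrwTimes t₀ tf, 0 < a t)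
    (ha : ContDiffOn ℝ (⊤ : ℕ∞) a (flrwTimes t₀ tf))
    (ha_zero : Tendsto a (𝓝[>] t₀) (𝓝 0)) {t₁ b : ℝ} (ht₁ : t₁ ∈ flrwTimes t₀ tf)
    (hb : b ∈ flrwTimes t₀ tf)
    (h_div : Tendsto
      (fun t => ∫ t' in t..t₁, a t' * ∫ t'' in t'..t₁, curvatureTerm κ a t'')
      (𝓝[>] t₀) atBot) :
    Tendsto (fun t => a t * curvSin κ (∫ y in t..b, 1 / a y)) (𝓝[>] t₀) (𝓝 0) := by
  have hO := isOpen_flrwTimes t₀ tf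
  have hOC := ordConnected_flrwTimes t₀ tf
  have hne : ∀ t ∈ flrwTimes t₀ tf, a t ≠ 0 := fun t ht => (ha_pos t ht).ne'
  have hmem : ∀ t ∈ Ioc t₀ b, t ∈ flrwTimes t₀ tf := fun t ht =>
    ⟨ht.1, (EReal.coe_le_coe_iff.2 ht.2).trans_lt hb.2⟩
  have hA : ∀ t ∈ flrwTimes t₀ tf, ContDiffAt ℝ 2 a t := fun t ht =>
    contDiffAt_infty.1 (ha.contDiffAt (hO.mem_nhds ht)) 2
  have hda : ∀ t ∈ flrwTimes t₀ tf, HasDerivAt a (deriv a t) t := fun t ht =>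
    ((hA t ht).differentiableAt (by norm_num)).hasDerivAt
  set η : ℝ → ℝ := fun t => ∫ y in t..b, 1 / a y with hη
  have hdη : ∀ t ∈ flrwTimes t₀ tf, HasDerivAt η (-(1 / a t)) t := fun t ht =>
    hasDerivAt_integral_left hO hOC (continuousOn_const.div ha.continuousOn hne) ht hb
  set k₁ : ℝ → ℝ := fun t => ∫ y in t..t₁, curvatureTerm κ a y with hk₁
  have hdk : ∀ t ∈ flrwTimes t₀ tf, HasDerivAt k₁ (-curvatureTerm κ a t) t := fun t ht =>
    hasDerivAt_integral_left hO hOC (continuousOn_curvatureTerm ha_pos ha) ht ht₁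
  set D : ℝ → ℝ := fun t => ∫ y in t..t₁, a y * k₁ y with hD
  have hdD : ∀ t ∈ flrwTimes t₀ tf, HasDerivAt D (-(a t * k₁ t)) t := fun t ht =>
    hasDerivAt_integral_left hO hOC (ha.continuousOn.mul fun t ht =>
      (hdk t ht).continuousAt.continuousWithinAt) ht ht₁
  have hη0 : ∀ t ∈ Ioc t₀ b, 0 ≤ η t := fun t ht =>
    intervalIntegral.integral_nonneg ht.2 fun y hy =>
      (one_div_pos.2 (ha_pos y (hmem y ⟨ht.1.trans_le hy.1, hy.2⟩))).le
  -- A solution of `p'' + κ p = 0` in `η` that dominates `sn_κ(η)` and, unlike it, is still positive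
  -- at `η = 0`. Below, `p'` is the derivative in `η`, so that `dp/dt = -p' / a`.
  set p : ℝ → ℝ := fun t => curvCos κ (η t) + curvSin κ (η t) with hp
  set p' : ℝ → ℝ := fun t => -κ * curvSin κ (η t) + curvCos κ (η t) with hp'
  have hSpos : ∀ t ∈ Ioc t₀ b, 0 ≤ curvSin κ (η t) := fun t ht => by
    rw [← curvSin_zero κ]
    exact curvSin_mono_of_nonpos hκ (hη0 t ht)
  have hppos : ∀ t ∈ Ioc t₀ b, 0 < p t := fun t ht =>
    add_pos_of_pos_of_nonneg (curvCos_pos_of_nonpos hκ _) (hSpos t ht)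
  have hdS : ∀ t ∈ flrwTimes t₀ tf, HasDerivAt (fun t => curvSin κ (η t))
      (curvCos κ (η t) * -(1 / a t)) t := fun t ht => (hasDerivAt_curvSin κ _).comp t (hdη t ht)
  have hdC : ∀ t ∈ flrwTimes t₀ tf, HasDerivAt (fun t => curvCos κ (η t))
      (-κ * curvSin κ (η t) * -(1 / a t)) t := fun t ht =>
    (hasDerivAt_curvCos κ _).comp t (hdη t ht)
  have hdp : ∀ t ∈ flrwTimes t₀ tf, HasDerivAt p (-(p' t / a t)) t := fun t ht => by
    convert! (hdC t ht).add (hdS t ht) using 1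
    simp only [hp']; ring
  have hdp' : ∀ t ∈ flrwTimes t₀ tf, HasDerivAt p' (κ * p t / a t) t := fun t ht => by
    convert! ((hdS t ht).const_mul (-κ)).add (hdC t ht) using 1
    simp only [hp]; ring
  -- Normalised so that `(log (a p))' = a u`; then `u` satisfies a Riccati equation whose source is
  -- exactly `curvatureTerm`.
  set u : ℝ → ℝ := fun t => (deriv a t * p t - p' t) / (a t ^ 2 * p t) with hu
  have hdu : ∀ t ∈ Ioc t₀ b, HasDerivAt u (curvatureTerm κ a t - a t * u t ^ 2) t := by
    intro t ht
    have ht' := hmem t ht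
    have h0 := hne t ht'
    have h1 := (hppos t ht).ne'
    have := (((hA t ht').hasDerivAt_deriv.fun_mul (hdp t ht')).fun_sub (hdp' t ht')).fun_div
      (((hda t ht').fun_pow 2).fun_mul (hdp t ht')) (mul_ne_zero (pow_ne_zero 2 h0) h1)
    convert! this using 1
    simp only [curvatureTerm, hu]
    field_simp
    ring
  set L : ℝ → ℝ := fun t => Real.log (a t * p t) with hL
  have hdL : ∀ t ∈ Ioc t₀ b, HasDerivAt L (a t * u t) t := by
    intro t ht
    have ht' := hmem t ht
    have h0 := hne t ht'
    have h1 := (hppos t ht).ne'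
    convert! ((hda t ht').fun_mul (hdp t ht')).log (mul_ne_zero h0 h1) using 1
    simp only [hu]
    field_simp
    ring
  -- Adding `k₁` cancels the source and leaves the derivative `-a u² ≤ 0`, so `u + k₁` can only grow
  -- towards `t₀`.
  set c := u b + k₁ b with hc
  have hF1 : ∀ t ∈ Ioc t₀ b, c ≤ u t + k₁ t := by
    have hder : ∀ t ∈ Ioc t₀ b, HasDerivAt (fun t => u t + k₁ t) (-(a t * u t ^ 2)) t :=
      fun t ht => by
        convert! (hdu t ht).fun_add (hdk t (hmem t ht)) using 1
        ring
    have hanti : AntitoneOn (fun t => u t + k₁ t) (Ioc t₀ b) := by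
      refine antitoneOn_of_deriv_nonpos (convex_Ioc _ _)
        (fun t ht => (hder t ht).continuousAt.continuousWithinAt)
        (fun t ht => (hder t (interior_subset ht)).differentiableAt.differentiableWithinAt)
        fun t ht => ?_
      rw [(hder t (interior_subset ht)).deriv]
      have := ha_pos t (hmem t (interior_subset ht))
      nlinarith [mul_nonneg this.le (sq_nonneg (u t))]
    exact fun t ht => hanti ht ⟨hb.1, le_rfl⟩ ht.2
  obtain ⟨d, hd, hda1⟩ : ∃ d ∈ Ioc t₀ b, ∀ t ∈ Ioc t₀ d, a t ≤ 1 := by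
    have h1 : ∀ᶠ t in 𝓝[>] t₀, a t < 1 := ha_zero.eventually (gt_mem_nhds one_pos)
    obtain ⟨d, hd, hsub⟩ := mem_nhdsGT_iff_exists_Ioc_subset.1 h1
    exact ⟨min d b, ⟨lt_min hd hb.1, min_le_right _ _⟩, fun t ht =>
      (hsub ⟨ht.1, ht.2.trans (min_le_left _ _)⟩).le⟩
  have hsub : Ioc t₀ d ⊆ Ioc t₀ b := Ioc_subset_Ioc_right hd.2
  -- The derivative of `L - D` is `a (u + k₁) ≥ a c ≥ -|c|`, the last step because `a ≤ 1` here; the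
  -- linear term absorbs this loss. Hence `L ≤ D + const` near `t₀`.
  have hF2 : MonotoneOn (fun t => L t - D t + |c| * t) (Ioc t₀ d) := by
    have hder : ∀ t ∈ Ioc t₀ d, HasDerivAt (fun t => L t - D t + |c| * t)
        (a t * (u t + k₁ t) + |c|) t := fun t ht => by
      convert! ((hdL t (hsub ht)).fun_sub (hdD t (hmem t (hsub ht)))).fun_add
        ((hasDerivAt_id t).const_mul |c|) using 1
      ring
    refine monotoneOn_of_deriv_nonneg (convex_Ioc _ _)
      (fun t ht => (hder t ht).continuousAt.continuousWithinAt)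
      (fun t ht => (hder t (interior_subset ht)).differentiableAt.differentiableWithinAt)
      fun t ht => ?_
    have ht := interior_subset ht
    rw [(hder t ht).deriv]
    have h1 := ha_pos t (hmem t (hsub ht))
    have h2 := hda1 t ht
    have h3 := mul_le_mul_of_nonneg_left (hF1 t (hsub ht)) h1.le
    have h4 : -|c| ≤ a t * c := by
      have : |a t * c| ≤ |c| := by
        rw [abs_mul, abs_of_pos h1]
        exact mul_le_of_le_one_left (abs_nonneg c) h2
      exact (neg_le_neg this).trans (neg_abs_le _)
    linarith
  have hev : ∀ᶠ t in 𝓝[>] t₀, t ∈ Ioc t₀ d := Ioc_mem_nhdsGT hd.1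
  have hLbot : Tendsto L (𝓝[>] t₀) atBot := by
    refine tendsto_atBot_mono' _ ?_
      (tendsto_atBot_add_const_right _ (L d - D d + |c| * d - |c| * t₀) h_div)
    filter_upwards [hev] with t ht
    have h1 := hF2 ht ⟨hd.1, le_rfl⟩ ht.2
    have h2 : |c| * t₀ ≤ |c| * t := mul_le_mul_of_nonneg_left ht.1.le (abs_nonneg c)
    simp only at h1
    change L t ≤ D t + _
    linarith
  refine squeeze_zero' ?_ ?_ (Real.tendsto_exp_atBot.comp hLbot)
  · filter_upwards [hev] with t ht
    exact mul_nonneg (ha_pos t (hmem t (hsub ht))).le (hSpos t (hsub ht))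
  · filter_upwards [hev] with t ht
    have h1 := ha_pos t (hmem t (hsub ht))
    rw [Function.comp, hL, Real.exp_log (mul_pos h1 (hppos t (hsub ht)))]
    refine mul_le_mul_of_nonneg_left ?_ h1.le
    simp only [hp]
    linarith [curvCos_pos_of_nonpos hκ (η t)]

/-! ### The fixed normal, uniqueness for the spatial equation, and conserved momentum. -/

/-- A `3 × 3` matrix with rows `v`, `w`, `0` is singular, even when `v` and `w` are dependent. -/
theorem exists_ne_zero_orthogonal_pair (v w : Fin 3 → ℝ) : ∃ e : Fin 3 → ℝ, e ≠ 0 ∧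
    v 0 * e 0 + v 1 * e 1 + v 2 * e 2 = 0 ∧ w 0 * e 0 + w 1 * e 1 + w 2 * e 2 = 0 := by
  have hdet : (Matrix.of ![v, w, 0]).det = 0 :=
    Matrix.det_eq_zero_of_row_eq_zero 2 fun _ => rfl
  obtain ⟨e, he, h⟩ := Matrix.exists_mulVec_eq_zero_iff.2 hdet
  refine ⟨e, he, ?_, ?_⟩
  · simpa [Matrix.mulVec, dotProduct, Fin.sum_univ_three] using congrFun h 0
  · simpa [Matrix.mulVec, dotProduct, Fin.sum_univ_three] using congrFun h 1

theorem eq_of_hasDerivAt_zero {I : Set ℝ} (hI : IsOpen I) (hI' : I.OrdConnected) {f : ℝ → ℝ}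
    (hf : ∀ x ∈ I, HasDerivAt f 0 x) {x y : ℝ} (hx : x ∈ I) (hy : y ∈ I) : f x = f y :=
  hI.is_const_of_deriv_eq_zero hI'.isPreconnected
    (fun z hz => (hf z hz).differentiableAt.differentiableWithinAt)
    (fun z hz => (hf z hz).deriv) hx hy

/-- A function whose derivative is dominated by a nonvanishing derivative has the smaller
increments. -/
theorem abs_sub_le_abs_sub_of_abs_deriv_le {I : Set ℝ} (hI' : I.OrdConnected)
    {f g f' g' : ℝ → ℝ} (hf : ∀ x ∈ I, HasDerivAt f (f' x) x)
    (hg : ∀ x ∈ I, HasDerivAt g (g' x) x) (hg0 : ∀ x ∈ I, g' x ≠ 0)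
    (hle : ∀ x ∈ I, |f' x| ≤ |g' x|) {x y : ℝ} (hx : x ∈ I) (hy : y ∈ I) :
    |f x - f y| ≤ |g x - g y| := by
  have key : ∀ {x y : ℝ}, x ∈ I → y ∈ I → x < y → |f y - f x| ≤ |g y - g x| := by
    intro x y hx hy hxy
    have hsub := hI'.out hx hy
    -- Cauchy's mean value theorem; no sign of `g'` is needed.
    obtain ⟨c, hc, h⟩ := exists_ratio_hasDerivAt_eq_ratio_slope f f' hxy
      (fun z hz => (hf z (hsub hz)).continuousAt.continuousWithinAt)
      (fun z hz => hf z (hsub (Ioo_subset_Icc_self hz))) g g'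
      (fun z hz => (hg z (hsub hz)).continuousAt.continuousWithinAt)
      (fun z hz => hg z (hsub (Ioo_subset_Icc_self hz)))
    have hcI := hsub (Ioo_subset_Icc_self hc)
    have h1 := congrArg abs h
    rw [abs_mul, abs_mul] at h1
    have h2 : |f y - f x| * |g' c| ≤ |g y - g x| * |g' c| := by
      rw [← h1]
      exact mul_le_mul_of_nonneg_left (hle c hcI) (abs_nonneg _)
    exact le_of_mul_le_mul_right h2 (abs_pos.2 (hg0 c hcI))
  rcases lt_trichotomy x y with h | rfl | h
  · rw [abs_sub_comm, abs_sub_comm (g x)]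
    exact key hx hy h
  · simp
  · exact key hy hx h

/-- The initial value problem for the equation of the spatial coordinates: `θ` is the arc length
with speed `r`, and `h = -r' / (2 r)`. -/
theorem eq_zero_of_spatial_ode {κ : ℝ} {I : Set ℝ} (hI : IsOpen I) (hI' : I.OrdConnected)
    {z z' z'' θ r h : ℝ → ℝ} (hz : ∀ τ ∈ I, HasDerivAt z (z' τ) τ)
    (hz' : ∀ τ ∈ I, HasDerivAt z' (z'' τ) τ) (hθ : ∀ τ ∈ I, HasDerivAt θ (-r τ) τ)
    (hr : ∀ τ ∈ I, HasDerivAt r (-2 * h τ * r τ) τ) (hr0 : ∀ τ ∈ I, r τ ≠ 0)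
    (hode : ∀ τ ∈ I, z'' τ + 2 * h τ * z' τ + κ * r τ ^ 2 * z τ = 0)
    {τ₂ : ℝ} (hτ₂ : τ₂ ∈ I) (h0 : z τ₂ = 0) (h1 : z' τ₂ = 0) {τ : ℝ} (hτ : τ ∈ I) : z τ = 0 := by
  have hS : ∀ τ ∈ I, HasDerivAt (fun τ => curvSin κ (θ τ)) (curvCos κ (θ τ) * -r τ) τ :=
    fun τ hτ => (hasDerivAt_curvSin κ _).comp τ (hθ τ hτ)
  have hC : ∀ τ ∈ I, HasDerivAt (fun τ => curvCos κ (θ τ)) (-κ * curvSin κ (θ τ) * -r τ) τ :=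
    fun τ hτ => (hasDerivAt_curvCos κ _).comp τ (hθ τ hτ)
  have hq : ∀ τ ∈ I, HasDerivAt (fun τ => z' τ / r τ) (-κ * r τ * z τ) τ := fun τ hτ => by
    have hne := hr0 τ hτ
    convert! (hz' τ hτ).fun_div (hr τ hτ) hne using 1
    field_simp
    linear_combination -hode τ hτ
  -- In the variable `θ` the equation is `z_θθ + κ z = 0`, with `z_θ = -z' / r`. The two
  -- combinations `hP` and `hQ` are constant, hence zero, and `cn_κ² + κ sn_κ² = 1` recovers `z`
  -- from them.
  have hP := eq_of_hasDerivAt_zero hI hI'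
    (f := fun τ => z τ * curvCos κ (θ τ) + z' τ / r τ * curvSin κ (θ τ)) (fun τ hτ => by
      have hne := hr0 τ hτ
      convert! ((hz τ hτ).fun_mul (hC τ hτ)).fun_add ((hq τ hτ).fun_mul (hS τ hτ)) using 1
      field_simp
      ring) hτ hτ₂
  have hQ := eq_of_hasDerivAt_zero hI hI'
    (f := fun τ => z' τ / r τ * curvCos κ (θ τ) - κ * (z τ * curvSin κ (θ τ))) (fun τ hτ => by
      have hne := hr0 τ hτ
      convert! ((hq τ hτ).fun_mul (hC τ hτ)).fun_sub
        (((hz τ hτ).fun_mul (hS τ hτ)).const_mul κ) using 1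
      field_simp
      ring) hτ hτ₂
  simp only [h0, h1, zero_mul, zero_div, mul_zero, add_zero, sub_zero] at hP hQ
  linear_combination curvCos κ (θ τ) * hP - curvSin κ (θ τ) * hQ
    - z τ * curvCos_sq_add κ (θ τ)

namespace IsFLRWGeodesic

variable {κ t₀ : ℝ} {a : ℝ → ℝ} {tf : EReal} {I : Set ℝ} {γ : ℝ → Fin 5 → ℝ}

theorem hasDerivAt_deriv_apply (hγ : IsFLRWGeodesic κ a t₀ tf I γ) (hI : IsOpen I) {τ : ℝ}
    (hτ : τ ∈ I) (i : Fin 5) :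
    HasDerivAt (fun σ => deriv γ σ i) (deriv (deriv fun σ => γ σ i) τ) τ := by
  have h2 := hγ.contDiffAt_two hI hτ
  rw [← deriv_deriv_apply_eq h2]
  exact hasDerivAt_pi.1 ((h2.derivWithin (m := 1) (by norm_num)).differentiableAt
    (by norm_num)).hasDerivAt i

/-- The conserved spatial momentum of a geodesic. -/
theorem momentum_eq (hγ : IsFLRWGeodesic κ a t₀ tf I γ) (hI : IsOpen I) (hI' : I.OrdConnected)
    (ha_pos : ∀ t ∈ flrwTimes t₀ tf, 0 < a t)
    (ha : ContDiffOn ℝ (⊤ : ℕ∞) a (flrwTimes t₀ tf)) {ε : ℝ}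
    (hε : ∀ τ ∈ I, flrwInner κ a (γ τ) (deriv γ τ) (deriv γ τ) = -ε) {τ τ' : ℝ}
    (hτ : τ ∈ I) (hτ' : τ' ∈ I) :
    a (γ τ 0) ^ 2 * (a (γ τ 0) ^ 2 * spatialInner κ (deriv γ τ) (deriv γ τ)) =
      a (γ τ' 0) ^ 2 * (a (γ τ' 0) ^ 2 * spatialInner κ (deriv γ τ') (deriv γ τ')) := by
  have hN : ∀ τ ∈ I, a (γ τ 0) ^ 2 * spatialInner κ (deriv γ τ) (deriv γ τ) =
      deriv γ τ 0 ^ 2 - ε := fun τ hτ => by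
    have := hε τ hτ
    rw [flrwInner] at this
    linear_combination this
  -- The normalisation turns `a² |ẋ|²` into `t'² - ε`, so the time component of the geodesic
  -- equation alone gives conservation.
  have h := eq_of_hasDerivAt_zero hI hI' (f := fun τ => a (γ τ 0) ^ 2 * (deriv γ τ 0 ^ 2 - ε))
    (fun τ hτ => by
      have ha1 : HasDerivAt (fun τ => a (γ τ 0)) (deriv a (γ τ 0) * deriv γ τ 0) τ :=
        ((hγ.contDiffAt_scale ha hτ).differentiableAt (by norm_num)).hasDerivAt.comp τ
          (hγ.hasDerivAt_apply hI hτ 0)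
      convert! (ha1.fun_pow 2).fun_mul
        (((hγ.hasDerivAt_deriv_apply hI hτ 0).fun_pow 2).sub_const ε) using 1
      rw [← hN τ hτ]
      have := hγ.time_eq hI ha_pos ha hτ
      push_cast
      linear_combination (-2 * a (γ τ 0) ^ 2 * deriv γ τ 0) * this) hτ hτ'
  rw [hN τ hτ, hN τ' hτ']
  exact h

end IsFLRWGeodesic

/-! ### Construction of the Jacobi field and its limit. -/

theorem mainTheorem1
    (κ : ℝ) (t₀ : ℝ) (tf : EReal) (a : ℝ → ℝ)
    -- the scale factor: positive and smooth on `(t₀, tf)`, vanishing at `t₀`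
    (ha_pos : ∀ t ∈ flrwTimes t₀ tf, 0 < a t)
    (ha_smooth : ContDiffOn ℝ (⊤ : ℕ∞) a (flrwTimes t₀ tf))
    (ha_zero : Tendsto a (𝓝[>] t₀) (𝓝 0))
    -- a non-spacelike geodesic `γ` running into the singularity
    (I : Set ℝ) (hI_open : IsOpen I) (hI_conn : I.OrdConnected)
    (γ : ℝ → Fin 5 → ℝ) (hγ : IsFLRWGeodesic κ a t₀ tf I γ)
    (hγ_causal : (∀ τ ∈ I, flrwInner κ a (γ τ) (deriv γ τ) (deriv γ τ) = -1) ∨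
      (∀ τ ∈ I, flrwInner κ a (γ τ) (deriv γ τ) (deriv γ τ) = 0))
    (hγ_sing : ∀ t > t₀, ∃ τ ∈ I, γ τ 0 < t)
    -- `γ` is not comoving: `C > 0`, where `C = a(t)² g_ij γ̇ⁱ γ̇ʲ` (constant along `γ`)
    (C : ℝ) (hC_pos : 0 < C) (τ₁ : ℝ) (hτ₁ : τ₁ ∈ I)
    (hC : C = a (γ τ₁ 0) ^ 2 *
      (a (γ τ₁ 0) ^ 2 * spatialInner κ (deriv γ τ₁) (deriv γ τ₁)))
    -- the two integral conditions
    (t₁ : ℝ) (ht₁ : t₁ ∈ flrwTimes t₀ tf)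
    (h_div : Tendsto
      (fun t => ∫ t' in t..t₁, a t' * ∫ t'' in t'..t₁, curvatureTerm κ a t'')
      (𝓝[>] t₀) atBot)
    (h_pos : ∃ α : ℝ, 0 ≤ α ∧
      Tendsto (fun t => ∫ t' in t..t₁, max (focusingFun κ C a t') 0) (𝓝[>] t₀) (𝓝 α))
    (τ₂ : ℝ) (hτ₂ : τ₂ ∈ I) :
    (∃ τ' ∈ I, γ τ' 0 < γ τ₂ 0 ∧ ConjugateAlong κ a I γ τ' τ₂) ∨
      ConjugateToSingularity κ a t₀ I γ τ₂ := by
  right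
  -- Timelike is `ε = 1`, null is `ε = 0`; later only `ε ≥ 0` matters.
  obtain ⟨ε, hε0, hε⟩ : ∃ ε : ℝ, 0 ≤ ε ∧
      ∀ τ ∈ I, flrwInner κ a (γ τ) (deriv γ τ) (deriv γ τ) = -ε := by
    rcases hγ_causal with h | h
    · exact ⟨1, zero_le_one, h⟩
    · exact ⟨0, le_rfl, by simpa using h⟩
  have hapos : ∀ τ ∈ I, 0 < a (γ τ 0) := fun τ hτ => ha_pos _ (hγ.mapsTo hτ).1
  have hCτ : ∀ τ ∈ I, a (γ τ 0) ^ 2 *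
      (a (γ τ 0) ^ 2 * spatialInner κ (deriv γ τ) (deriv γ τ)) = C := fun τ hτ => by
    rw [hC, hγ.momentum_eq hI_open hI_conn ha_pos ha_smooth hε hτ hτ₁]
  have hcoord := fun τ hτ => hγ.hasDerivAt_apply hI_open (τ := τ) hτ
  have hda : ∀ τ ∈ I, HasDerivAt (fun τ => a (γ τ 0)) (deriv a (γ τ 0) * deriv γ τ 0) τ :=
    fun τ hτ => ((hγ.contDiffAt_scale ha_smooth hτ).differentiableAt (by norm_num)).hasDerivAt.comp τ
      (hcoord τ hτ 0)
  -- the arc length in `Σ_κ`, measured from `γ τ₂`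
  set r : ℝ → ℝ := fun τ => √C / a (γ τ 0) ^ 2 with hr
  set H : ℝ → ℝ := fun τ => deriv a (γ τ 0) / a (γ τ 0) * deriv γ τ 0 with hH
  have hrpos : ∀ τ ∈ I, 0 < r τ := fun τ hτ =>
    div_pos (Real.sqrt_pos.2 hC_pos) (pow_pos (hapos τ hτ) 2)
  have hN : ∀ τ ∈ I, spatialInner κ (deriv γ τ) (deriv γ τ) = r τ ^ 2 := fun τ hτ => by
    have h0 := (hapos τ hτ).ne'
    rw [hr]
    simp only [div_pow]
    rw [Real.sq_sqrt hC_pos.le, ← hCτ τ hτ]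
    field_simp
  have htime : ∀ τ ∈ I, deriv γ τ 0 ^ 2 = (a (γ τ 0) * r τ) ^ 2 + ε := fun τ hτ => by
    have := hε τ hτ
    rw [flrwInner, hN τ hτ] at this
    linear_combination -this
  have hrC : ContDiffOn ℝ (⊤ : ℕ∞) r I := by
    have h1 : ContDiffOn ℝ (⊤ : ℕ∞) (fun τ => a (γ τ 0)) I :=
      ha_smooth.comp (contDiffOn_pi.1 hγ.smooth 0) fun τ hτ => (hγ.mapsTo hτ).1
    exact contDiffOn_const.div (h1.pow 2) fun τ hτ => pow_ne_zero 2 (hapos τ hτ).ne'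
  have hdr : ∀ τ ∈ I, HasDerivAt r (-2 * H τ * r τ) τ := fun τ hτ => by
    have h0 := (hapos τ hτ).ne'
    convert! (hasDerivAt_const τ √C).fun_div ((hda τ hτ).fun_pow 2) (pow_ne_zero 2 h0) using 1
    simp only [hH, hr]
    field_simp
    ring
  set θ : ℝ → ℝ := fun τ => ∫ y in τ..τ₂, r y with hθ
  have hdθ : ∀ τ ∈ I, HasDerivAt θ (-r τ) τ := fun τ hτ =>
    hasDerivAt_integral_left hI_open hI_conn hrC.continuousOn hτ hτ₂
  have hθ₂ : θ τ₂ = 0 := intervalIntegral.integral_same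
  have hθC : ContDiffOn ℝ (⊤ : ℕ∞) θ I := by
    rw [contDiffOn_infty_iff_deriv_of_isOpen hI_open]
    exact ⟨fun τ hτ => (hdθ τ hτ).differentiableAt.differentiableWithinAt,
      hrC.neg.congr fun τ hτ => (hdθ τ hτ).deriv⟩
  set ψ : ℝ → ℝ := fun τ => curvSin κ (θ τ) with hψ
  have hψC : ContDiffOn ℝ (⊤ : ℕ∞) ψ I := (contDiff_curvSin κ _).comp_contDiffOn hθC
  have hdψ : ∀ τ ∈ I, HasDerivAt ψ (curvCos κ (θ τ) * -r τ) τ := fun τ hτ =>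
    (hasDerivAt_curvSin κ _).comp τ (hdθ τ hτ)
  have hψ₂ : ψ τ₂ = 0 := by rw [hψ]; simp only [hθ₂, curvSin_zero]
  -- the normal of a totally geodesic hypersurface containing `γ`
  obtain ⟨e, he0, he1, he2⟩ := exists_ne_zero_orthogonal_pair
    ![γ τ₂ 1, γ τ₂ 2, γ τ₂ 3] ![deriv γ τ₂ 1, deriv γ τ₂ 2, deriv γ τ₂ 3]
  simp only [Matrix.cons_val] at he1 he2
  have hdz : ∀ τ ∈ I, HasDerivAt (fun τ => γ τ 1 * e 0 + γ τ 2 * e 1 + γ τ 3 * e 2)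
      (deriv γ τ 1 * e 0 + deriv γ τ 2 * e 1 + deriv γ τ 3 * e 2) τ := fun τ hτ =>
    (((hcoord τ hτ 1).mul_const _).fun_add ((hcoord τ hτ 2).mul_const _)).fun_add
      ((hcoord τ hτ 3).mul_const _)
  -- `e · x` solves the spatial equation, being a fixed combination of solutions, and has zero
  -- initial data at `τ₂`.
  have hz : ∀ τ ∈ I, γ τ 1 * e 0 + γ τ 2 * e 1 + γ τ 3 * e 2 = 0 := fun τ hτ => by
    have h2 := fun τ hτ => hγ.hasDerivAt_deriv_apply hI_open (τ := τ) hτ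
    refine eq_zero_of_spatial_ode (κ := κ) hI_open hI_conn hdz (fun τ hτ =>
      (((h2 τ hτ 1).mul_const (e 0)).fun_add ((h2 τ hτ 2).mul_const (e 1))).fun_add
      ((h2 τ hτ 3).mul_const (e 2))) hdθ hdr (fun τ hτ => (hrpos τ hτ).ne')
      (fun τ hτ => ?_) hτ₂ he1 he2 hτ
    have h := fun k hk => hγ.space_eq hI_open ha_pos ha_smooth hτ k hk
    have h1 := h 1 (by decide)
    have h2 := h 2 (by decide)
    have h3 := h 3 (by decide)
    rw [hN τ hτ, (hcoord τ hτ _).deriv] at h1 h2 h3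
    change deriv (deriv fun σ => γ σ 1) τ + 2 * H τ * deriv γ τ 1 + κ * r τ ^ 2 * γ τ 1 = 0 at h1
    change deriv (deriv fun σ => γ σ 2) τ + 2 * H τ * deriv γ τ 2 + κ * r τ ^ 2 * γ τ 2 = 0 at h2
    change deriv (deriv fun σ => γ σ 3) τ + 2 * H τ * deriv γ τ 3 + κ * r τ ^ 2 * γ τ 3 = 0 at h3
    linear_combination e 0 * h1 + e 1 * h2 + e 2 * h3
  have hz' : ∀ τ ∈ I, deriv γ τ 1 * e 0 + deriv γ τ 2 * e 1 + deriv γ τ 3 * e 2 = 0 :=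
    fun τ hτ => (hdz τ hτ).unique ((hasDerivAt_const τ (0 : ℝ)).congr_of_eventuallyEq (by
      filter_upwards [hI_open.mem_nhds hτ] with σ hσ using hz σ hσ))
  refine ⟨ambientField ψ e, hγ.isJacobiField_ambientField hI_open ha_pos ha_smooth hψC hz
    (fun τ hτ => ?_), fun τ hτ => ?_, fun hprop => ?_, ?_, ?_⟩
  · have h1 : deriv ψ =ᶠ[𝓝 τ] fun τ => curvCos κ (θ τ) * -r τ := by
      filter_upwards [hI_open.mem_nhds hτ] with σ hσ using (hdψ σ hσ).deriv
    have h2 : HasDerivAt (fun τ => curvCos κ (θ τ) * -r τ) _ τ :=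
      ((hasDerivAt_curvCos κ _).comp τ (hdθ τ hτ)).fun_mul (hdr τ hτ).fun_neg
    rw [h1.deriv_eq, h2.deriv, (hdψ τ hτ).deriv, hN τ hτ]
    change _ + 2 * H τ * _ + κ * r τ ^ 2 * curvSin κ (θ τ) = 0
    simp only [Function.comp]
    ring
  · simp only [flrwInner, spatialInner, ambientField, Matrix.cons_val]
    linear_combination a (γ τ 0) ^ 2 * ψ τ * hz' τ hτ
  -- The field has no time component while `t'² = (a r)² + ε > 0`, so a proportionality factor must
  -- be zero. Then `ψ` vanishes identically, against `ψ'(τ₂) = -r(τ₂) ≠ 0`.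
  · have hzero : ∀ τ ∈ I, ψ τ = 0 := fun τ hτ => by
      obtain ⟨c, hc⟩ := hprop τ hτ
      have h0 : deriv γ τ 0 ≠ 0 := by
        have h1 := htime τ hτ
        have h2 := mul_pos (hapos τ hτ) (hrpos τ hτ)
        intro h
        rw [h] at h1
        nlinarith
      have hc0 : c = 0 := by
        have := congrFun hc 0
        simp only [ambientField, Matrix.cons_val, Pi.smul_apply, smul_eq_mul] at this
        exact (mul_eq_zero.1 this.symm).resolve_right h0
      rw [hc0, zero_smul] at hc
      by_contra hne
      refine he0 (funext fun k => ?_)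
      have h1 := congrFun hc 1
      have h2 := congrFun hc 2
      have h3 := congrFun hc 3
      simp only [ambientField, Matrix.cons_val, Pi.zero_apply, mul_eq_zero, hne, false_or]
        at h1 h2 h3
      fin_cases k
      · exact h1
      · exact h2
      · exact h3
    have h1 := (hdψ τ₂ hτ₂).unique ((hasDerivAt_const τ₂ (0 : ℝ)).congr_of_eventuallyEq (by
      filter_upwards [hI_open.mem_nhds hτ₂] with σ hσ using hzero σ hσ))
    rw [hθ₂, curvCos_zero, one_mul, neg_eq_zero] at h1
    exact (hrpos τ₂ hτ₂).ne' h1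
  · funext k
    fin_cases k <;> simp [ambientField, hψ₂]
  · have ht : Tendsto (fun τ => γ τ 0) (towardsSingularity t₀ I γ) (𝓝[>] t₀) :=
      tendsto_comap.mono_left inf_le_left
    have hIev : ∀ᶠ τ in towardsSingularity t₀ I γ, τ ∈ I :=
      mem_inf_of_right (mem_principal_self I)
    have hlim : Tendsto (fun τ => a (γ τ 0) * ψ τ) (towardsSingularity t₀ I γ) (𝓝 0) := by
      rcases lt_or_ge 0 κ with hκ | hκ
      · have h1 := (ha_zero.comp ht).mul_const (1 / √κ)
        rw [zero_mul] at h1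
        refine squeeze_zero_norm' ?_ h1
        filter_upwards [hIev] with τ hτ
        rw [Real.norm_eq_abs, abs_mul, abs_of_pos (hapos τ hτ)]
        exact mul_le_mul_of_nonneg_left (abs_curvSin_le_of_pos hκ _) (hapos τ hτ).le
      · have ht₂ := (hγ.mapsTo hτ₂).1
        have h1 := (tendsto_scale_mul_curvSin hκ ha_pos ha_smooth ha_zero ht₁ ht₂ h_div).comp ht
        refine squeeze_zero_norm' ?_ h1
        have hlt : ∀ᶠ τ in towardsSingularity t₀ I γ, γ τ 0 ∈ Ioc t₀ (γ τ₂ 0) :=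
          ht.eventually (Ioc_mem_nhdsGT ht₂.1)
        filter_upwards [hIev, hlt] with τ hτ hτt
        rw [Real.norm_eq_abs, abs_mul, abs_of_pos (hapos τ hτ)]
        refine mul_le_mul_of_nonneg_left (abs_curvSin_le_of_nonpos hκ ?_) (hapos τ hτ).le
        have hη : ∀ τ ∈ I, HasDerivAt (fun τ => ∫ y in (γ τ 0)..(γ τ₂ 0), 1 / a y)
            (-(1 / a (γ τ 0)) * deriv γ τ 0) τ := fun τ hτ =>
          HasDerivAt.comp (h₂ := fun t => ∫ y in t..(γ τ₂ 0), 1 / a y) τ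
            (hasDerivAt_integral_left (isOpen_flrwTimes t₀ tf) (ordConnected_flrwTimes t₀ tf)
              (continuousOn_const.div ha_smooth.continuousOn fun t ht => (ha_pos t ht).ne')
              (hγ.mapsTo hτ).1 ht₂) (hcoord τ hτ 0)
        have hle : ∀ τ ∈ I, r τ ≤ |-(1 / a (γ τ 0)) * deriv γ τ 0| := fun τ hτ => by
          have h0 := hapos τ hτ
          have h2 : a (γ τ 0) * r τ ≤ |deriv γ τ 0| :=
            le_abs_self (a (γ τ 0) * r τ) |>.trans (sq_le_sq.1 (by linarith [htime τ hτ]))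
          rw [abs_mul, abs_neg, abs_of_pos (one_div_pos.2 h0), one_div_mul_eq_div, le_div_iff₀ h0]
          linarith
        -- Both `θ` and the conformal time vanish at `τ₂`, so `r ≤ |t'| / a` integrates to `|θ| ≤
        -- |η|`, whichever way time runs along `γ`; and `η ≥ 0` since `t ≤ t₂`.
        have h3 := abs_sub_le_abs_sub_of_abs_deriv_le hI_conn hdθ hη
          (fun τ hτ => abs_pos.1 ((hrpos τ hτ).trans_le (hle τ hτ)))
          (fun τ hτ => by rw [abs_neg, abs_of_pos (hrpos τ hτ)]; exact hle τ hτ) hτ hτ₂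
        rw [hθ₂, intervalIntegral.integral_same, sub_zero, sub_zero] at h3
        rwa [abs_of_nonneg (intervalIntegral.integral_nonneg hτt.2 fun y hy => ?_)] at h3
        exact (one_div_pos.2 (ha_pos y ⟨hτt.1.trans_le hy.1,
          (EReal.coe_le_coe_iff.2 hy.2).trans_lt ht₂.2⟩)).le
    have h1 := (hlim.pow 2).mul_const (e 0 ^ 2 + e 1 ^ 2 + e 2 ^ 2)
    rw [zero_pow two_ne_zero, zero_mul] at h1
    refine h1.congr fun τ => ?_
    simp only [flrwInner, spatialInner, ambientField, Matrix.cons_val]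
    ring
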